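/- Fix integers $d\ge 0$ and $N>d+2$, reals $\tau_0,\sigma_0,\sigma>0$ and a level $\alpha\in(0,1)$, and let $z=z_{1-\alpha/2}$ be the $(1-\alpha/2)$-quantile of the standard normal distribution. For experiments $k=1,2,\dots$ with $N$ users each, let $$Y_{k,i}=a_k+\tau_kD_{k,i}+\theta_k^{\top}X_{k,i}+\epsilon_{k,i},\qquad 1\le i\le N,$$ with treatment assignments $D_{k,i}\in\{0,1\}$, covariates $X_{k,i}\in\mathbb R^{d}$, and arbitrary (possibly random) $a_k\in\mathbb R$, $\theta_k\in\mathbb R^d$. Let $t_k$ be the $N\times(2+d)$ matrix with rows $(1,D_{k,i},X_{k,i}^\top)$, $I=(0,1,0,\dots,0)^\top\in\mathbb R^{2+d}$, $b_k=\sqrt{N\,I^\top(t_k^\top t_k)^{-1}I}$, and $$\hat\tau_k=I^\top(t_k^\top t_k)^{-1}t_k^\top Y_k,\qquad s_k^2=\tfrac{1}{N-2-d}\,\bigl\|Y_k-t_k(t_k^\top t_k)^{-1}t_k^\top Y_k\bigr\|_2^2 .$$ Assume: the triples $(\tau_k,(D_k,X_k),\epsilon_k)$ are independent across $k$; $\tau_k\sim\mathcal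 N(\tau_0,\sigma_0^2)$; for each $k$ the $\epsilon_{k,i}$ are i.i.d. $\mathcal N(0,\sigma^2)$ and $(\epsilon_{k,i})_i$ is independent of $(\tau_k,D_k,X_k)$; $t_k^\top t_k$ is almost surely invertible; the $b_k$ are identically distributed with $\mathbb E[b_k^2]<\infty$, and $b_k$ is independent of $\tau_k$. For $K$ experiments put $\hat\tau_0=\frac1K\sum_{k\le K}\hat\tau_k$, $\hat\sigma^2=\frac1K\sum_{k\le K}s_k^2$, $$\hat\beta^*(b)=\frac{b^2\hat\sigma^2}{\frac1K\sum_{k\le K}(\hat\tau_k-\hat\tau_0)^2-\frac1N\,\hat\sigma^2\cdot\frac1K\sum_{k\le K}b_k^2}+\frac{z\,b\sqrt{N\hat\sigma^2}}{\hat\tau_0},\qquad \beta^*(b)=\frac{\sigma^2b^2}{\sigma_0^2}+\frac{\sqrt N\,z\,\sigma b}{\tau_0}.$$ For a scale function $\beta$, an anchor $\tau$ and $s\ge 0$ let $\bar\tau_k=\frac{N}{N+\beta(b_k)}\hat\tau_k+\frac{\beta(b_k)}{N+\beta(b_k)}\tau$ and $$r_K(\beta,\tau,s)=\frac1K\sum_{k\le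 K:\ \bar\tau_k>\frac{N}{N+\beta(b_k)}\frac{s\,b_k}{\sqrt N}z}\tau_k .$$ Write $\tilde r(\beta,\tau)=r_K(\beta,\tau,\sigma)$ and $\bar r(\beta,\tau)=r_K(\beta,\tau,\hat\sigma)$. Call $\beta$ admissible if it is measurable and nonnegative on $(0,\infty)$. Then, as $K\to\infty$: 1. $\hat\tau_0\to\tau_0$ in probability. 2. $\hat\beta^*(b)\to\beta^*(b)$ in probability for every fixed $b>0$, and $\hat\beta^*(b_k)\to\beta^*(b_k)$ in probability for every fixed $k$. 3. For every admissible $\beta$ the variable $\tilde r(\beta,\tau_0)$ is integrable and the limit $\mathcal R(\beta,\tau_0)=\lim_{K\to\infty}\mathbb E[\tilde r(\beta,\tau_0)]$ exists; $\beta^*$ is admissible and maximizes $\mathcal R(\cdot,\tau_0)$ over admissible functions, and any admissible maximizer $\beta$ satisfies $\beta(b_k)=\beta^*(b_k)$ almost surely for every $k$. The realized reward of the personalized data-driven rule converges to this optimal value: $\bar r(\hat\beta^*(\cdot),\hat\tau_0)\to\mathcal R(\beta^*(\cdot),\tau_0)$ in probability. -/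

import Mathlib

open MeasureTheory ProbabilityTheory Filter Topology

noncomputable section

namespace DPTR

/-- The quantile function of the standard normal distribution (used only at levels in `(0, 1)`);
the critical value `z_p` is `normalQuantile p`. -/
def normalQuantile (p : ℝ) : ℝ :=
  sInf {x : ℝ | p ≤ cdf (gaussianReal 0 1) x}

section OLS

variable {N d : ℕ}

/-- The regressor matrix of one experiment: row `i` is `(1, D i, X i)`. -/
def designMatrix (D : Fin N → ℝ) (X : Fin N → Fin d → ℝ) : Matrix (Fin N) (Fin (d + 2)) ℝ :=
  Matrix.of fun i => Fin.cons 1 (Fin.cons (D i) (X i))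

/-- The vector `I = (0, 1, 0, …, 0)` selecting the treatment coefficient. -/
def treatVec (d : ℕ) : Fin (d + 2) → ℝ := Pi.single 1 1

/-- The OLS coefficient vector `(tᵀ t)⁻¹ tᵀ Y`. -/
def olsCoef (t : Matrix (Fin N) (Fin (d + 2)) ℝ) (Y : Fin N → ℝ) : Fin (d + 2) → ℝ :=
  Matrix.mulVec (t.transpose * t)⁻¹ (Matrix.mulVec t.transpose Y)

/-- The OLS estimator `Iᵀ (tᵀ t)⁻¹ tᵀ Y` of the treatment effect. -/
def olsEffect (t : Matrix (Fin N) (Fin (d + 2)) ℝ) (Y : Fin N → ℝ) : ℝ :=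
  treatVec d ⬝ᵥ olsCoef t Y

/-- The vector of OLS residuals. -/
def olsResidual (t : Matrix (Fin N) (Fin (d + 2)) ℝ) (Y : Fin N → ℝ) : Fin N → ℝ :=
  Y - Matrix.mulVec t (olsCoef t Y)

/-- The unbiased noise-variance estimator: residual sum of squares over `N - 2 - d`. -/
def olsNoiseVar (t : Matrix (Fin N) (Fin (d + 2)) ℝ) (Y : Fin N → ℝ) : ℝ :=
  (1 / ((N : ℝ) - 2 - (d : ℝ))) * (olsResidual t Y ⬝ᵥ olsResidual t Y)

/-- `b = √(N Iᵀ (tᵀ t)⁻¹ I)`. -/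
def designScale (t : Matrix (Fin N) (Fin (d + 2)) ℝ) : ℝ :=
  Real.sqrt ((N : ℝ) * (treatVec d ⬝ᵥ Matrix.mulVec (t.transpose * t)⁻¹ (treatVec d)))

end OLS

/-- The shrinkage estimator with scale `β` and anchor `τ`. -/
def shrink (N : ℕ) (β τ τhat : ℝ) : ℝ :=
  (N : ℝ) / ((N : ℝ) + β) * τhat + β / ((N : ℝ) + β) * τ

/-- The scale function `β*(b) = σ² b² / σ₀² + √N z σ b / τ₀`. -/
def betaStar (N : ℕ) (τ₀ σ₀ σ z : ℝ) (b : ℝ) : ℝ :=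
  σ ^ 2 * b ^ 2 / σ₀ ^ 2 + Real.sqrt (N : ℝ) * z * σ * b / τ₀

/-- Admissible scale functions: measurable, and nonnegative at every positive argument. -/
def scaleFunctions : Set (ℝ → ℝ) :=
  {β | Measurable β ∧ ∀ b, 0 < b → 0 ≤ β b}

/-- The primitive random quantities of a sequence of experiments with `N` users each and
`d` covariates: effects `τ k`, intercepts `a k`, covariate coefficients `θ k`,
treatment assignments `D k`, covariates `X k`, noises `ε k`. -/
structure Experiments (Ω : Type*) (N d : ℕ) where
  τ : ℕ → Ω → ℝ
  a : ℕ → Ω → ℝ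
  θ : ℕ → Ω → Fin d → ℝ
  D : ℕ → Ω → Fin N → ℝ
  X : ℕ → Ω → Fin N → Fin d → ℝ
  ε : ℕ → Ω → Fin N → ℝ

namespace Experiments

variable {Ω : Type*} {N d : ℕ}

/-- Outcomes `Y_{k,i} = a_k + τ_k D_{k,i} + θ_kᵀ X_{k,i} + ε_{k,i}`. -/
def Y (E : Experiments Ω N d) (k : ℕ) (ω : Ω) : Fin N → ℝ := fun i =>
  E.a k ω + E.τ k ω * E.D k ω i + E.θ k ω ⬝ᵥ E.X k ω i + E.ε k ω i

/-- The regressor matrix `t_k`. -/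
def t (E : Experiments Ω N d) (k : ℕ) (ω : Ω) : Matrix (Fin N) (Fin (d + 2)) ℝ :=
  designMatrix (E.D k ω) (E.X k ω)

/-- The quantity `b_k`. -/
def b (E : Experiments Ω N d) (k : ℕ) (ω : Ω) : ℝ := designScale (E.t k ω)

/-- The estimator of `τ_k` from experiment `k` alone. -/
def tauHat (E : Experiments Ω N d) (k : ℕ) (ω : Ω) : ℝ := olsEffect (E.t k ω) (E.Y k ω)

/-- The estimator `s_k²` of the noise variance from experiment `k` alone. -/
def sSq (E : Experiments Ω N d) (k : ℕ) (ω : Ω) : ℝ := olsNoiseVar (E.t k ω) (E.Y k ω)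

/-- The average of `f` over the first `K` experiments. -/
def avg (K : ℕ) (f : ℕ → ℝ) : ℝ := (1 / (K : ℝ)) * ∑ k ∈ Finset.range K, f k

/-- The pooled anchor, the average of the estimators of the first `K` experiments. -/
def tauHat0 (E : Experiments Ω N d) (K : ℕ) (ω : Ω) : ℝ := avg K fun k => E.tauHat k ω

/-- The pooled noise variance. -/
def sigmaHatSq (E : Experiments Ω N d) (K : ℕ) (ω : Ω) : ℝ := avg K fun k => E.sSq k ω

/-- The pooled noise standard deviation. -/
def sigmaHat (E : Experiments Ω N d) (K : ℕ) (ω : Ω) : ℝ := Real.sqrt (E.sigmaHatSq K ω)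

/-- The personalized plug-in scale `β̂*(x)` computed from the first `K` experiments, with
critical value `z`, as a function of its argument `x`. -/
def betaHat (E : Experiments Ω N d) (z : ℝ) (K : ℕ) (ω : Ω) (x : ℝ) : ℝ :=
  x ^ 2 * E.sigmaHatSq K ω /
      ((avg K fun k => (E.tauHat k ω - E.tauHat0 K ω) ^ 2)
        - (1 / (N : ℝ)) * (E.sigmaHatSq K ω * avg K fun k => (E.b k ω) ^ 2))
    + z * x * Real.sqrt ((N : ℝ) * E.sigmaHatSq K ω) / E.tauHat0 K ω

/-- The realized per-experiment reward over the first `K` experiments of the rule with scale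
function `β`, anchor `τ`, noise standard deviation `s` and critical value `z`: experiment `k`
is rolled out if its shrunk estimate exceeds `N / (N + β(b_k)) * (s b_k / √N) * z`. -/
def reward (E : Experiments Ω N d) (z s : ℝ) (β : ℝ → ℝ) (τ : ℝ) (K : ℕ) (ω : Ω) : ℝ :=
  (1 / (K : ℝ)) * ∑ k ∈ (Finset.range K).filter (fun k =>
      (N : ℝ) / ((N : ℝ) + β (E.b k ω)) * (s * E.b k ω / Real.sqrt (N : ℝ)) * z
        < shrink N (β (E.b k ω)) τ (E.tauHat k ω)),
    E.τ k ω

/-- The stochastic assumptions on the experiments: independence across experiments, normal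
treatment effects with mean `τ₀` and variance `σ₀²`, i.i.d. normal noise with variance `σ²`
independent of the effect and of the design, almost surely nonsingular designs, and `b_k`
identically distributed, independent of `τ_k` and square integrable. Intercepts and covariate
coefficients are arbitrary. -/
structure IsOLSModel [MeasurableSpace Ω] (E : Experiments Ω N d) (P : Measure Ω)
    (τ₀ σ₀ σ : ℝ) : Prop where
  measurable_τ : ∀ k, Measurable (E.τ k)
  measurable_a : ∀ k, Measurable (E.a k)
  measurable_θ : ∀ k, Measurable (E.θ k)
  measurable_D : ∀ k, Measurable (E.D k)
  measurable_X : ∀ k, Measurable (E.X k)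
  measurable_ε : ∀ k, Measurable (E.ε k)
  D_binary : ∀ k ω i, E.D k ω i = 0 ∨ E.D k ω i = 1
  indep_experiments : iIndepFun (fun k ω => (E.τ k ω, (E.D k ω, E.X k ω), E.ε k ω)) P
  law_τ : ∀ k, P.map (E.τ k) = gaussianReal τ₀ (σ₀ ^ 2).toNNReal
  law_ε : ∀ k i, P.map (fun ω => E.ε k ω i) = gaussianReal 0 (σ ^ 2).toNNReal
  indep_ε : ∀ k, iIndepFun (fun i ω => E.ε k ω i) P
  indep_noise : ∀ k, IndepFun (E.ε k) (fun ω => (E.τ k ω, (E.D k ω, E.X k ω))) P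
  nonsingular : ∀ k, ∀ᵐ ω ∂P, IsUnit ((E.t k ω).transpose * E.t k ω).det
  indep_b_τ : ∀ k, IndepFun (E.b k) (E.τ k) P
  identDistrib_b : ∀ k, IdentDistrib (E.b k) (E.b 0) P P
  integrable_b_sq : Integrable (fun ω => (E.b 0 ω) ^ 2) P

end Experiments

end DPTR

end

/-! Writing `Y = t c + ε` with `c = (a, τ, θ)`, OLS returns `c` exactly plus its response to the
noise. For an invertible design, `τ̂ = τ + w ⬝ᵥ ε` with `‖w‖² = b² / N`, and `s²` depends only on
the design and `ε`. Given the design, `τ̂ - τ` is therefore `(σ b / √N) Z` with `Z` standard normal.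
Hence the triples `(τ_k, b_k, τ̂_k)` are pairwise independent with one common law (`map_obs`), even
though only the `b_k`, not the designs, share a law. The strong law applies to them; for `σ̂²` a
Chebyshev argument suffices, since `E s_k² = σ²` and `s_k²` is dominated by a multiple of `‖ε_k‖²`.

Rolling out experiment `k` means `τ̂_k > h(b_k)` with `h(b) = s b z / √N - β(b) τ / N`, so choosing
`β` is choosing a threshold for each `b`. With `s = σ` and `τ = τ₀`, the effect in the expected
reward may be replaced by its posterior mean given `τ̂`, which is increasing in `τ̂` and vanishes at
`-σ² b² τ₀ / (N σ₀²)`. Thresholding there is optimal, uniquely so because `τ̂` has full support, and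
solving `h(b) = -σ² b² τ₀ / (N σ₀²)` for `β(b)` gives `β*` (`selectedMean_le_and_eq_iff`,
`betaStar_threshold`).

With plug-in quantities the terms in `z` cancel exactly, so the data-driven rule is `τ̂_k > -c_K
b_k²` with a single random scalar `c_K` (`reward_betaHat_eq`). Replacing `c_K` by its limit `c`
affects only units with `τ̂_k` within a small multiple of `b_k²` of `-c b_k²`. Their average
contribution has a limit that is arbitrarily small, as `τ̂` almost surely avoids the threshold
(`tendsto_avg_threshold`, `exists_tendsto_avg_near_threshold`). Convergence in probability is
checked along almost surely convergent subsequences. -/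

noncomputable section

namespace DPTR

/-! ### Linear algebra of least squares. -/

section LinearAlgebra

open Matrix

variable {N d : ℕ}

/-- The vector of weights with which the OLS effect estimator averages the outcomes. -/
def treatWeight (t : Matrix (Fin N) (Fin (d + 2)) ℝ) : Fin N → ℝ :=
  t *ᵥ ((tᵀ * t)⁻¹ *ᵥ treatVec d)

/-- The matrix mapping outcomes to OLS residuals. -/
def residualMaker (t : Matrix (Fin N) (Fin (d + 2)) ℝ) : Matrix (Fin N) (Fin N) ℝ :=
  1 - t * (tᵀ * t)⁻¹ * tᵀ

lemma gram_inv_transpose (t : Matrix (Fin N) (Fin (d + 2)) ℝ) :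
    ((tᵀ * t)⁻¹)ᵀ = (tᵀ * t)⁻¹ := by
  rw [Matrix.transpose_nonsing_inv, Matrix.transpose_mul, Matrix.transpose_transpose]

/-- Exact recovery on the column space is what makes the arbitrary intercepts and covariate
coefficients drop out of `τ̂` and of the residuals. -/
lemma olsCoef_mulVec_add {t : Matrix (Fin N) (Fin (d + 2)) ℝ} (ht : IsUnit (tᵀ * t).det)
    (c : Fin (d + 2) → ℝ) (e : Fin N → ℝ) :
    olsCoef t (t *ᵥ c + e) = c + olsCoef t e := by
  simp only [olsCoef, Matrix.mulVec_add, Matrix.mulVec_mulVec]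
  rw [Matrix.nonsing_inv_mul _ ht, Matrix.one_mulVec]

lemma treatVec_dotProduct (c : Fin (d + 2) → ℝ) : treatVec d ⬝ᵥ c = c 1 := by
  simp [treatVec]

lemma olsEffect_eq_treatWeight (t : Matrix (Fin N) (Fin (d + 2)) ℝ) (e : Fin N → ℝ) :
    olsEffect t e = treatWeight t ⬝ᵥ e := by
  simp only [olsEffect, olsCoef, treatWeight]
  rw [Matrix.dotProduct_mulVec, Matrix.dotProduct_mulVec, ← Matrix.mulVec_transpose,
    ← Matrix.mulVec_transpose, Matrix.transpose_transpose, gram_inv_transpose]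

lemma olsEffect_mulVec_add {t : Matrix (Fin N) (Fin (d + 2)) ℝ} (ht : IsUnit (tᵀ * t).det)
    (c : Fin (d + 2) → ℝ) (e : Fin N → ℝ) :
    olsEffect t (t *ᵥ c + e) = c 1 + treatWeight t ⬝ᵥ e := by
  rw [← olsEffect_eq_treatWeight, olsEffect, olsCoef_mulVec_add ht, dotProduct_add,
    treatVec_dotProduct, olsEffect]

lemma olsNoiseVar_mulVec_add {t : Matrix (Fin N) (Fin (d + 2)) ℝ} (ht : IsUnit (tᵀ * t).det)
    (c : Fin (d + 2) → ℝ) (e : Fin N → ℝ) :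
    olsNoiseVar t (t *ᵥ c + e) = olsNoiseVar t e := by
  have : olsResidual t (t *ᵥ c + e) = olsResidual t e := by
    rw [olsResidual, olsCoef_mulVec_add ht, Matrix.mulVec_add, olsResidual]
    abel
  rw [olsNoiseVar, this, olsNoiseVar]

lemma treatWeight_dotProduct_self {t : Matrix (Fin N) (Fin (d + 2)) ℝ}
    (ht : IsUnit (tᵀ * t).det) :
    treatWeight t ⬝ᵥ treatWeight t = treatVec d ⬝ᵥ ((tᵀ * t)⁻¹ *ᵥ treatVec d) := by
  rw [← olsEffect_eq_treatWeight, olsEffect, olsCoef, treatWeight, Matrix.mulVec_mulVec,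
    Matrix.mulVec_mulVec, Matrix.mul_assoc, Matrix.nonsing_inv_mul _ ht, Matrix.one_mulVec]

lemma designScale_sq {t : Matrix (Fin N) (Fin (d + 2)) ℝ} (ht : IsUnit (tᵀ * t).det) :
    designScale t ^ 2 = N * (treatWeight t ⬝ᵥ treatWeight t) := by
  rw [designScale, ← treatWeight_dotProduct_self ht, Real.sq_sqrt]
  exact mul_nonneg (Nat.cast_nonneg _) (Finset.sum_nonneg fun i _ => mul_self_nonneg _)

lemma designScale_pos (hN : 0 < N) {t : Matrix (Fin N) (Fin (d + 2)) ℝ}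
    (ht : IsUnit (tᵀ * t).det) : 0 < designScale t := by
  rw [designScale, ← treatWeight_dotProduct_self ht]
  refine Real.sqrt_pos.2 (mul_pos (Nat.cast_pos.2 hN) ?_)
  refine lt_of_le_of_ne (Finset.sum_nonneg fun i _ => mul_self_nonneg _) fun h => ?_
  -- With zero weights the effect estimator would vanish identically, yet it returns 1 on the
  -- treatment column.
  have hw : treatWeight t = 0 := dotProduct_self_eq_zero.1 h.symm
  have h1 : olsCoef t (t *ᵥ treatVec d) = treatVec d := by
    have := olsCoef_mulVec_add ht (treatVec d) 0
    simpa [olsCoef] using this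
  have h2 : olsEffect t (t *ᵥ treatVec d) = 1 := by
    rw [olsEffect, h1, treatVec_dotProduct]; simp [treatVec]
  rw [olsEffect_eq_treatWeight, hw] at h2
  simp at h2

lemma olsResidual_eq (t : Matrix (Fin N) (Fin (d + 2)) ℝ) (e : Fin N → ℝ) :
    olsResidual t e = residualMaker t *ᵥ e := by
  simp [olsResidual, olsCoef, residualMaker, Matrix.sub_mulVec, Matrix.mulVec_mulVec,
    Matrix.mul_assoc]

lemma residualMaker_transpose (t : Matrix (Fin N) (Fin (d + 2)) ℝ) :
    (residualMaker t)ᵀ = residualMaker t := by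
  rw [residualMaker, Matrix.transpose_sub, Matrix.transpose_one, Matrix.transpose_mul,
    Matrix.transpose_mul, gram_inv_transpose, Matrix.transpose_transpose, Matrix.mul_assoc]

lemma residualMaker_mul_self {t : Matrix (Fin N) (Fin (d + 2)) ℝ} (ht : IsUnit (tᵀ * t).det) :
    residualMaker t * residualMaker t = residualMaker t := by
  have h : (t * (tᵀ * t)⁻¹ * tᵀ) * (t * (tᵀ * t)⁻¹ * tᵀ) = t * (tᵀ * t)⁻¹ * tᵀ := by
    calc _ = t * ((tᵀ * t)⁻¹ * ((tᵀ * t) * ((tᵀ * t)⁻¹ * tᵀ))) := by simp only [Matrix.mul_assoc]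
      _ = _ := by rw [Matrix.mul_nonsing_inv_cancel_left _ _ ht, Matrix.mul_assoc]
  rw [residualMaker, sub_mul, mul_sub, mul_sub, h]
  simp

/-- Cyclicity of the trace turns the projection onto the column space into the identity of size `d +
2`. This is the source of the divisor in `s²`. -/
lemma trace_residualMaker {t : Matrix (Fin N) (Fin (d + 2)) ℝ} (ht : IsUnit (tᵀ * t).det) :
    (residualMaker t).trace = N - 2 - d := by
  rw [residualMaker, Matrix.trace_sub, Matrix.trace_mul_comm, ← Matrix.mul_assoc,
    Matrix.mul_nonsing_inv _ ht]
  simp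
  ring

lemma olsResidual_dotProduct_self {t : Matrix (Fin N) (Fin (d + 2)) ℝ}
    (ht : IsUnit (tᵀ * t).det) (e : Fin N → ℝ) :
    olsResidual t e ⬝ᵥ olsResidual t e = ∑ i, ∑ j, residualMaker t i j * (e i * e j) := by
  rw [olsResidual_eq, Matrix.dotProduct_mulVec, ← Matrix.mulVec_transpose,
    residualMaker_transpose, Matrix.mulVec_mulVec, residualMaker_mul_self ht]
  simp only [dotProduct, Matrix.mulVec, Finset.sum_mul]
  exact Finset.sum_congr rfl fun i _ => Finset.sum_congr rfl fun j _ => by ring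

/-- An orthogonal projection is a contraction: `r ⬝ᵥ r = r ⬝ᵥ e`, and `‖e - r‖² ≥ 0`. It bounds `s²`
by a quantity free of the design. -/
lemma olsResidual_dotProduct_self_le {t : Matrix (Fin N) (Fin (d + 2)) ℝ}
    (ht : IsUnit (tᵀ * t).det) (e : Fin N → ℝ) :
    olsResidual t e ⬝ᵥ olsResidual t e ≤ e ⬝ᵥ e := by
  set r := olsResidual t e with hr
  have h1 : r ⬝ᵥ r = r ⬝ᵥ e := by
    have : residualMaker t *ᵥ r = r := by
      rw [hr, olsResidual_eq, Matrix.mulVec_mulVec, residualMaker_mul_self ht]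
    conv_lhs => rw [hr, olsResidual_eq, ← olsResidual_eq, ← hr]
    nth_rewrite 2 [hr]
    rw [olsResidual_eq, Matrix.dotProduct_mulVec, ← Matrix.mulVec_transpose,
      residualMaker_transpose, this]
  have h2 : 0 ≤ (e - r) ⬝ᵥ (e - r) := Finset.sum_nonneg fun i _ => mul_self_nonneg _
  rw [sub_dotProduct, dotProduct_sub, dotProduct_sub, dotProduct_comm e r] at h2
  linarith

lemma outcome_eq_mulVec (a τ : ℝ) (θ : Fin d → ℝ) (D : Fin N → ℝ) (X : Fin N → Fin d → ℝ)
    (e : Fin N → ℝ) :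
    (fun i => a + τ * D i + θ ⬝ᵥ X i + e i) =
      designMatrix D X *ᵥ (Fin.cons a (Fin.cons τ θ)) + e := by
  funext i
  simp only [designMatrix, Matrix.mulVec, Pi.add_apply, dotProduct, Fin.sum_univ_succ,
    Matrix.of_apply, Fin.cons_zero, Fin.cons_succ, one_mul]
  have : ∑ x, θ x * X i x = ∑ x, X i x * θ x := Finset.sum_congr rfl fun _ _ => mul_comm _ _
  rw [this]
  ring

end LinearAlgebra

/-! ### Measurability of the estimators in design and outcomes. -/

section Measurability

open Matrix

variable {N d : ℕ} {α : Type*} [MeasurableSpace α]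

lemma measurable_matrix_det {n : ℕ} {A : α → Matrix (Fin n) (Fin n) ℝ}
    (hA : ∀ i j, Measurable fun x => A x i j) : Measurable fun x => (A x).det := by
  simp only [Matrix.det_apply]
  exact Finset.measurable_sum _ fun s _ =>
    (Finset.measurable_prod _ fun i _ => hA _ _).const_smul _

/-- Cramer's formula: the adjugate has determinants as entries. Singular matrices need no separate
treatment, since the inverted determinant is then 0. -/
lemma measurable_matrix_inv {n : ℕ} {A : α → Matrix (Fin n) (Fin n) ℝ}
    (hA : ∀ i j, Measurable fun x => A x i j) (i j : Fin n) :
    Measurable fun x => (A x)⁻¹ i j := by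
  simp only [Matrix.inv_def, Matrix.smul_apply, Matrix.adjugate_apply, smul_eq_mul,
    Ring.inverse_eq_inv']
  refine (measurable_matrix_det hA).inv.mul (measurable_matrix_det fun k l => ?_)
  by_cases hk : k = j
  · subst hk
    simp
  · simpa [Matrix.updateRow_ne hk] using hA k l

lemma measurable_designMatrix {D : α → Fin N → ℝ} {X : α → Fin N → Fin d → ℝ}
    (hD : Measurable D) (hX : Measurable X) (i : Fin N) (j : Fin (d + 2)) :
    Measurable fun x => designMatrix (D x) (X x) i j := by
  refine Fin.cases ?_ (fun j => Fin.cases ?_ (fun j => ?_) j) j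
  · simp [designMatrix]
  · simp only [designMatrix, Matrix.of_apply, Fin.cons_succ, Fin.cons_zero]
    fun_prop
  · simp only [designMatrix, Matrix.of_apply, Fin.cons_succ]
    fun_prop

variable {t : α → Matrix (Fin N) (Fin (d + 2)) ℝ} (ht : ∀ i j, Measurable fun x => t x i j)

include ht

lemma measurable_gram_inv (i j : Fin (d + 2)) :
    Measurable fun x => (((t x)ᵀ * t x)⁻¹) i j := by
  refine measurable_matrix_inv (fun i j => ?_) i j
  simp only [Matrix.mul_apply, Matrix.transpose_apply]
  exact Finset.measurable_sum _ fun k _ => (ht _ _).mul (ht _ _)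

lemma measurable_treatWeight : Measurable fun x => treatWeight (t x) := by
  refine measurable_pi_lambda _ fun i => ?_
  simp only [treatWeight, Matrix.mulVec, dotProduct]
  exact Finset.measurable_sum _ fun k _ => (ht _ _).mul
    (Finset.measurable_sum _ fun l _ => (measurable_gram_inv ht _ _).mul_const _)

lemma measurable_designScale : Measurable fun x => designScale (t x) := by
  simp only [designScale, Matrix.mulVec, dotProduct]
  exact (measurable_const.mul (Finset.measurable_sum _ fun k _ => measurable_const.mul
    (Finset.measurable_sum _ fun l _ => (measurable_gram_inv ht _ _).mul_const _))).sqrt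

lemma measurable_olsCoef {Y : α → Fin N → ℝ} (hY : Measurable Y) (i : Fin (d + 2)) :
    Measurable fun x => olsCoef (t x) (Y x) i := by
  simp only [olsCoef, Matrix.mulVec, dotProduct, Matrix.transpose_apply]
  exact Finset.measurable_sum _ fun k _ => (measurable_gram_inv ht _ _).mul
    (Finset.measurable_sum _ fun l _ => (ht _ _).mul (by fun_prop))

lemma measurable_olsEffect {Y : α → Fin N → ℝ} (hY : Measurable Y) :
    Measurable fun x => olsEffect (t x) (Y x) := by
  simp only [olsEffect, treatVec_dotProduct]
  exact measurable_olsCoef ht hY 1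

lemma measurable_olsNoiseVar {Y : α → Fin N → ℝ} (hY : Measurable Y) :
    Measurable fun x => olsNoiseVar (t x) (Y x) := by
  have h : ∀ i, Measurable fun x => olsResidual (t x) (Y x) i := fun i => by
    simp only [olsResidual, Matrix.mulVec, dotProduct, Pi.sub_apply]
    exact (by fun_prop : Measurable fun x => Y x i).sub (Finset.measurable_sum _ fun k _ =>
      (ht _ _).mul (measurable_olsCoef ht hY k))
  simp only [olsNoiseVar, dotProduct]
  exact measurable_const.mul (Finset.measurable_sum _ fun k _ => (h k).mul (h k))

end Measurability

/-! ### Linear forms in Gaussian vectors. -/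

section Laws

open NNReal

variable {Ω : Type*} [MeasurableSpace Ω] {P : Measure Ω} [IsProbabilityMeasure P]

/-- Both sides are centred Gaussian, so only the variances must match; the sign of `c` is
irrelevant. -/
lemma map_dotProduct_pi_gaussianReal {n : ℕ} (v : ℝ≥0) (w : Fin n → ℝ) (c : ℝ)
    (hc : c ^ 2 = v * (w ⬝ᵥ w)) :
    (Measure.pi fun _ : Fin n => gaussianReal 0 v).map (fun e => w ⬝ᵥ e) =
      (gaussianReal 0 1).map (fun x => c * x) := by
  set μ := Measure.pi fun _ : Fin n => gaussianReal 0 v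
  have hlaw : ∀ i : Fin n, μ.map (fun e => e i) = gaussianReal 0 v := fun i =>
    (measurePreserving_eval (fun _ : Fin n => gaussianReal 0 v) i).map_eq
  have hg : ∀ i : Fin n, HasGaussianLaw (fun e : Fin n → ℝ => w i * e i) μ := fun i => by
    have h : HasLaw (fun e : Fin n → ℝ => e i) (gaussianReal 0 v) μ :=
      ⟨(measurable_pi_apply i).aemeasurable, hlaw i⟩
    exact h.hasGaussianLaw.fun_smul (w i)
  have hi : iIndepFun (fun (i : Fin n) (e : Fin n → ℝ) => w i * e i) μ :=
    iIndepFun_pi (X := fun i x => w i * x) fun i => by fun_prop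
  have hmem : ∀ i, MemLp (fun x : ℝ => w i * x) 2 (gaussianReal 0 v) := fun i =>
    (memLp_id_gaussianReal' 2 (by simp)).const_mul (w i)
  have hvar : Var[fun e => ∑ i, w i * e i; μ] = v * (w ⬝ᵥ w) := by
    have := variance_sum_pi (μ := fun _ : Fin n => gaussianReal 0 v)
      (X := fun i x => w i * x) hmem
    have h2 : (∑ i, fun e : Fin n → ℝ => w i * e i) = fun e => ∑ i, w i * e i := by
      ext e; simp
    rw [h2] at this
    rw [this]
    simp only [dotProduct, Finset.mul_sum]
    refine Finset.sum_congr rfl fun i _ => ?_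
    rw [variance_const_mul (w i) (fun x => x), variance_fun_id_gaussianReal]
    ring
  have hmean : ∫ e, ∑ i, w i * e i ∂μ = 0 := by
    rw [integral_finsetSum _ fun i _ => (hg i).integrable]
    refine Finset.sum_eq_zero fun i _ => ?_
    rw [integral_const_mul]
    have hei : Measurable fun e : Fin n → ℝ => e i := measurable_pi_apply i
    have : ∫ e : Fin n → ℝ, e i ∂μ = ∫ x, x ∂(μ.map fun e => e i) :=
      (integral_map hei.aemeasurable aestronglyMeasurable_id).symm
    rw [this, hlaw i, integral_id_gaussianReal, mul_zero]
  have := (hi.hasGaussianLaw_fun_sum hg).map_eq_gaussianReal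
  rw [hmean, hvar, ← hc] at this
  rw [gaussianReal_map_const_mul]
  simp only [dotProduct]
  rw [this]
  congr 1
  · simp
  · ext; simp [sq_nonneg]

/-- A linear form with random weights in an independent Gaussian vector is a scale mixture of a
standard Gaussian variable which is independent of the weights. -/
lemma map_prodMk_dotProduct_of_indepFun {α : Type*} [MeasurableSpace α] {n : ℕ} {v : ℝ≥0}
    {U : Ω → α} {e : Ω → Fin n → ℝ} (hU : Measurable U) (he : Measurable e)
    (hlaw : P.map e = Measure.pi fun _ => gaussianReal 0 v) (hind : IndepFun U e P)
    {w : α → Fin n → ℝ} {c : α → ℝ} (hw : Measurable w) (hc : Measurable c)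
    (hwc : ∀ᵐ ω ∂P, c (U ω) ^ 2 = v * (w (U ω) ⬝ᵥ w (U ω))) :
    P.map (fun ω => (U ω, w (U ω) ⬝ᵥ e ω)) =
      ((P.map U).prod (gaussianReal 0 1)).map (fun p => (p.1, c p.1 * p.2)) := by
  have hdot : Measurable fun p : α × (Fin n → ℝ) => w p.1 ⬝ᵥ p.2 := by
    simp only [dotProduct]
    fun_prop
  have : IsProbabilityMeasure (P.map U) := Measure.isProbabilityMeasure_map hU.aemeasurable
  refine Measure.ext_of_lintegral _ fun f hf => ?_
  have h1 : P.map (fun ω => (U ω, w (U ω) ⬝ᵥ e ω)) =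
      ((P.map U).prod (P.map e)).map (fun p => (p.1, w p.1 ⬝ᵥ p.2)) := by
    rw [← hind.map_prod_eq_prod_map_map hU.aemeasurable he.aemeasurable,
      Measure.map_map (by fun_prop) (by fun_prop)]
    rfl
  rw [h1, hlaw, lintegral_map hf (by fun_prop), lintegral_map hf (by fun_prop),
    lintegral_prod _ (by fun_prop), lintegral_prod _ (by fun_prop)]
  have hae : ∀ᵐ u ∂(P.map U), c u ^ 2 = v * (w u ⬝ᵥ w u) := by
    refine (ae_map_iff hU.aemeasurable (measurableSet_eq_fun (by fun_prop) ?_)).2 hwc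
    simp only [dotProduct]
    fun_prop
  -- For fixed `u` in the outer integral the weights are deterministic.
  refine lintegral_congr_ae ?_
  filter_upwards [hae] with u hu
  have h2 := map_dotProduct_pi_gaussianReal v (w u) (c u) hu
  have hd : Measurable fun x : Fin n → ℝ => w u ⬝ᵥ x := by
    simp only [dotProduct]; fun_prop
  rw [← lintegral_map (μ := Measure.pi fun _ : Fin n => gaussianReal 0 v)
    (f := fun x => f (u, x)) (by fun_prop) hd, h2, lintegral_map (by fun_prop) (by fun_prop)]

end Laws

/-! ### Laws of large numbers. -/

section WeakLaw

open Experiments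

variable {Ω : Type*} [MeasurableSpace Ω] {P : Measure Ω} [IsProbabilityMeasure P]

/-- A weak law of large numbers for independent variables with common mean and uniformly bounded
second moments. -/
lemma tendstoInMeasure_avg_of_sq_le {X : ℕ → Ω → ℝ} {m C : ℝ} (hX : ∀ k, MemLp (X k) 2 P)
    (hind : Pairwise fun i j => IndepFun (X i) (X j) P) (hmean : ∀ k, P[X k] = m)
    (hC : ∀ k, ∫ ω, X k ω ^ 2 ∂P ≤ C) :
    TendstoInMeasure P (fun K ω => avg K fun k => X k ω) atTop (fun _ => m) := by
  rw [tendstoInMeasure_iff_dist]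
  intro δ hδ
  have hbound : ∀ K : ℕ, 0 < K → P {ω | δ ≤ dist (avg K fun k => X k ω) m} ≤
      ENNReal.ofReal (C / δ ^ 2 * (1 / (K : ℝ))) := fun K hK => by
    have hK' : (0 : ℝ) < K := Nat.cast_pos.2 hK
    have hmem : MemLp (fun ω => avg K fun k => X k ω) 2 P := by
      simp only [avg]
      exact (memLp_finsetSum _ fun k _ => hX k).const_mul _
    have hm : ∫ ω, avg K (fun k => X k ω) ∂P = m := by
      simp only [avg]
      rw [integral_const_mul, integral_finsetSum _ fun k _ => (hX k).integrable (by norm_num)]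
      simp only [hmean, Finset.sum_const, Finset.card_range, nsmul_eq_mul]
      field_simp
    -- By pairwise independence the variance of the average is at most `C / K`; Chebyshev's
    -- inequality then finishes.
    have hv : Var[fun ω => avg K fun k => X k ω; P] ≤ C * (1 / (K : ℝ)) := by
      simp only [avg]
      rw [variance_const_mul]
      have h2 : (fun ω => ∑ k ∈ Finset.range K, X k ω) = ∑ k ∈ Finset.range K, X k := by
        ext ω; simp
      rw [h2, IndepFun.variance_sum (fun k _ => hX k) (fun i _ j _ hij => hind hij)]
      have h3 : ∑ k ∈ Finset.range K, Var[X k; P] ≤ K * C := by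
        refine (Finset.sum_le_sum fun k _ => ?_).trans (b := ∑ k ∈ Finset.range K, C) (by simp)
        rw [variance_eq_sub (hX k)]
        have := hC k
        simp only [Pi.pow_apply]
        nlinarith [sq_nonneg (P[X k])]
      calc (1 / (K : ℝ)) ^ 2 * _ ≤ (1 / (K : ℝ)) ^ 2 * (K * C) := by gcongr
        _ = _ := by field_simp
    have := meas_ge_le_variance_div_sq hmem hδ
    rw [hm] at this
    simp only [Real.dist_eq]
    refine this.trans (ENNReal.ofReal_le_ofReal ?_)
    calc _ ≤ C * (1 / (K : ℝ)) / δ ^ 2 := by gcongr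
      _ = _ := by ring
  have hlim : Tendsto (fun K : ℕ => ENNReal.ofReal (C / δ ^ 2 * (1 / (K : ℝ)))) atTop (𝓝 0) := by
    have := ENNReal.tendsto_ofReal ((tendsto_one_div_atTop_nhds_zero_nat (𝕜 := ℝ)).const_mul
      (C / δ ^ 2))
    simpa using this
  refine tendsto_of_tendsto_of_tendsto_of_le_of_le' tendsto_const_nhds hlim
    (Eventually.of_forall fun _ => bot_le) ?_
  filter_upwards [eventually_gt_atTop 0] with K hK using hbound K hK

omit [IsProbabilityMeasure P] in
/-- The strong law of large numbers for averages of a function of an i.i.d. sequence. -/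
lemma ae_tendsto_avg_comp {α : Type*} [MeasurableSpace α] {V : ℕ → Ω → α}
    (hind : Pairwise fun i j => IndepFun (V i) (V j) P)
    (hid : ∀ k, IdentDistrib (V k) (V 0) P P) {f : α → ℝ} (hf : Measurable f)
    (hint : Integrable (fun ω => f (V 0 ω)) P) :
    ∀ᵐ ω ∂P, Tendsto (fun K => avg K fun k => f (V k ω)) atTop (𝓝 (∫ ω, f (V 0 ω) ∂P)) := by
  have := strong_law_ae_real (μ := P) (fun k ω => f (V k ω)) hint
    (fun i j hij => (hind hij).comp hf hf) (fun k => (hid k).comp hf)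
  filter_upwards [this] with ω hω
  refine hω.congr fun K => ?_
  simp only [avg]
  ring

end WeakLaw

/-! ### Posterior mean and the optimal threshold. -/

section Posterior

/-- For an effect `t ∼ N(τ₀, σ₀²)` observed with independent noise of standard deviation `s`, the
mean of the effect on the event that the observation exceeds `h`. -/
def selectedMean (τ₀ σ₀ s h : ℝ) : ℝ :=
  ∫ p : ℝ × ℝ, (if h < p.1 + s * p.2 then p.1 else 0)
    ∂((gaussianReal τ₀ (σ₀ ^ 2).toNNReal).prod (gaussianReal 0 1))

/-- The posterior mean of the effect given the observation `u`. -/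
def posteriorMean (τ₀ σ₀ s u : ℝ) : ℝ := τ₀ + σ₀ ^ 2 / (σ₀ ^ 2 + s ^ 2) * (u - τ₀)

variable (τ₀ σ₀ s : ℝ)

/-- Residual and observation are jointly Gaussian, so zero covariance suffices: `(1 - l) σ₀² - l s²
= 0` for the shrinkage factor `l`. -/
lemma indepFun_posterior_residual (hσ₀ : 0 < σ₀) :
    IndepFun (fun p : ℝ × ℝ => p.1 - posteriorMean τ₀ σ₀ s (p.1 + s * p.2))
      (fun p : ℝ × ℝ => p.1 + s * p.2)
      ((gaussianReal τ₀ (σ₀ ^ 2).toNNReal).prod (gaussianReal 0 1)) := by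
  set μ := (gaussianReal τ₀ (σ₀ ^ 2).toNNReal).prod (gaussianReal 0 1)
  set l := σ₀ ^ 2 / (σ₀ ^ 2 + s ^ 2) with hl
  set X : ℝ × ℝ → ℝ := Prod.fst
  set Z : ℝ × ℝ → ℝ := Prod.snd
  have hX : HasLaw X (gaussianReal τ₀ (σ₀ ^ 2).toNNReal) μ :=
    ⟨by fun_prop, by simp [X, μ]⟩
  have hZ : HasLaw Z (gaussianReal 0 1) μ := ⟨by fun_prop, by simp [Z, μ]⟩
  have hXZ : IndepFun X Z μ := indepFun_prod (X := id) (Y := id) measurable_id measurable_id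
  have hG := hXZ.hasGaussianLaw hX.hasGaussianLaw hZ.hasGaussianLaw
  -- `L₁` is the residual up to the constant `(1 - l) τ₀`, which is subtracted at the end.
  let L₁ : ℝ × ℝ →L[ℝ] ℝ := (1 - l) • ContinuousLinearMap.fst ℝ ℝ ℝ
    + (-(l * s)) • ContinuousLinearMap.snd ℝ ℝ ℝ
  let L₂ : ℝ × ℝ →L[ℝ] ℝ := ContinuousLinearMap.fst ℝ ℝ ℝ + s • ContinuousLinearMap.snd ℝ ℝ ℝ
  have hL := hG.map_fun (L₁.prod L₂)
  have hX2 : MemLp X 2 μ := hX.hasGaussianLaw.memLp_two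
  have hZ2 : MemLp Z 2 μ := hZ.hasGaussianLaw.memLp_two
  have hvX : cov[X, X; μ] = σ₀ ^ 2 := by
    rw [covariance_self hX.aemeasurable, hX.variance_eq, variance_id_gaussianReal,
      Real.coe_toNNReal _ (sq_nonneg _)]
  have hvZ : cov[Z, Z; μ] = 1 := by
    rw [covariance_self hZ.aemeasurable, hZ.variance_eq, variance_id_gaussianReal]
    simp
  have hcov : cov[(1 - l) • X + (-(l * s)) • Z, X + s • Z; μ] = 0 := by
    rw [covariance_add_left (hX2.const_smul _) (hZ2.const_smul _) (hX2.add (hZ2.const_smul _)),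
      covariance_smul_left, covariance_smul_left,
      covariance_add_right hX2 hX2 (hZ2.const_smul _),
      covariance_add_right hZ2 hX2 (hZ2.const_smul _), covariance_smul_right,
      covariance_smul_right, hXZ.covariance_eq_zero hX2 hZ2, hXZ.symm.covariance_eq_zero hZ2 hX2,
      hvX, hvZ, hl]
    have : 0 < σ₀ ^ 2 + s ^ 2 := by positivity
    field_simp
    ring
  have hind : IndepFun (fun p => L₁ p) (fun p => L₂ p) μ :=
    HasGaussianLaw.indepFun_of_covariance_eq_zero hL hcov
  have := hind.comp (φ := fun x => x - (1 - l) * τ₀) (ψ := id) (by fun_prop) measurable_id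
  convert! this using 1
  funext p
  simp [L₁, posteriorMean]
  ring

lemma memLp_fst_gaussian_prod :
    MemLp (fun p : ℝ × ℝ => p.1) 2
      ((gaussianReal τ₀ (σ₀ ^ 2).toNNReal).prod (gaussianReal 0 1)) :=
  (memLp_id_gaussianReal' 2 (by simp)).comp_fst _

lemma memLp_snd_gaussian_prod :
    MemLp (fun p : ℝ × ℝ => p.2) 2
      ((gaussianReal τ₀ (σ₀ ^ 2).toNNReal).prod (gaussianReal 0 1)) :=
  (memLp_id_gaussianReal' 2 (by simp)).comp_snd _

lemma integrable_fst_gaussian_prod :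
    Integrable (fun p : ℝ × ℝ => p.1)
      ((gaussianReal τ₀ (σ₀ ^ 2).toNNReal).prod (gaussianReal 0 1)) :=
  (memLp_fst_gaussian_prod τ₀ σ₀).integrable (by norm_num)

lemma integrable_snd_gaussian_prod :
    Integrable (fun p : ℝ × ℝ => p.2)
      ((gaussianReal τ₀ (σ₀ ^ 2).toNNReal).prod (gaussianReal 0 1)) :=
  (memLp_snd_gaussian_prod τ₀ σ₀).integrable (by norm_num)

lemma integral_fst_gaussian_prod :
    ∫ p : ℝ × ℝ, p.1 ∂((gaussianReal τ₀ (σ₀ ^ 2).toNNReal).prod (gaussianReal 0 1)) = τ₀ := by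
  rw [integral_fun_fst (fun x : ℝ => x)]
  simp [integral_id_gaussianReal]

lemma integral_snd_gaussian_prod :
    ∫ p : ℝ × ℝ, p.2 ∂((gaussianReal τ₀ (σ₀ ^ 2).toNNReal).prod (gaussianReal 0 1)) = 0 := by
  rw [integral_fun_snd (fun x : ℝ => x)]
  simp [integral_id_gaussianReal]

lemma integrable_posteriorMean :
    Integrable (fun p : ℝ × ℝ => posteriorMean τ₀ σ₀ s (p.1 + s * p.2))
      ((gaussianReal τ₀ (σ₀ ^ 2).toNNReal).prod (gaussianReal 0 1)) := by
  simp only [posteriorMean]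
  exact (integrable_const _).add ((((integrable_fst_gaussian_prod τ₀ σ₀).add
    ((integrable_snd_gaussian_prod τ₀ σ₀).const_mul s)).sub (integrable_const _)).const_mul _)

lemma integral_posterior_residual :
    ∫ p : ℝ × ℝ, (p.1 - posteriorMean τ₀ σ₀ s (p.1 + s * p.2))
      ∂((gaussianReal τ₀ (σ₀ ^ 2).toNNReal).prod (gaussianReal 0 1)) = 0 := by
  have h1 := integrable_fst_gaussian_prod τ₀ σ₀
  have h2 := (integrable_snd_gaussian_prod τ₀ σ₀).const_mul s
  have h3 : Integrable (fun p : ℝ × ℝ => p.1 + s * p.2)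
      ((gaussianReal τ₀ (σ₀ ^ 2).toNNReal).prod (gaussianReal 0 1)) := h1.add h2
  have h4 : Integrable (fun p : ℝ × ℝ => σ₀ ^ 2 / (σ₀ ^ 2 + s ^ 2) * (p.1 + s * p.2 - τ₀))
      ((gaussianReal τ₀ (σ₀ ^ 2).toNNReal).prod (gaussianReal 0 1)) :=
    (h3.sub (integrable_const _)).const_mul _
  rw [integral_sub h1 (integrable_posteriorMean τ₀ σ₀ s)]
  simp only [posteriorMean]
  rw [integral_add (integrable_const _) h4, integral_const_mul,
    integral_sub h3 (integrable_const _), integral_add h1 h2, integral_const_mul,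
    integral_fst_gaussian_prod, integral_snd_gaussian_prod]
  simp

/-- The residual has mean zero and is independent of the selection event, so it contributes nothing.
-/
lemma selectedMean_eq_integral_posteriorMean (hσ₀ : 0 < σ₀) (h : ℝ) :
    selectedMean τ₀ σ₀ s h = ∫ p : ℝ × ℝ,
      (if h < p.1 + s * p.2 then posteriorMean τ₀ σ₀ s (p.1 + s * p.2) else 0)
      ∂((gaussianReal τ₀ (σ₀ ^ 2).toNNReal).prod (gaussianReal 0 1)) := by
  set μ := (gaussianReal τ₀ (σ₀ ^ 2).toNNReal).prod (gaussianReal 0 1) with hμ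
  have hset : MeasurableSet {p : ℝ × ℝ | h < p.1 + s * p.2} :=
    measurableSet_lt (by fun_prop) (by fun_prop)
  have hint : ∀ f : ℝ × ℝ → ℝ, Integrable f μ →
      Integrable (fun p => if h < p.1 + s * p.2 then f p else 0) μ := fun f hf =>
    hf.indicator hset
  have hres : ∫ p : ℝ × ℝ, (if h < p.1 + s * p.2 then
      p.1 - posteriorMean τ₀ σ₀ s (p.1 + s * p.2) else 0) ∂μ = 0 := by
    have hψ : Measurable fun u : ℝ => if h < u then (1 : ℝ) else 0 :=
      Measurable.ite measurableSet_Ioi measurable_const measurable_const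
    have hind := (indepFun_posterior_residual τ₀ σ₀ s hσ₀).comp measurable_id hψ
    have := hind.integral_fun_mul_eq_mul_integral
      (((integrable_fst_gaussian_prod τ₀ σ₀).sub
        (integrable_posteriorMean τ₀ σ₀ s)).aestronglyMeasurable)
      (Measurable.ite hset measurable_const measurable_const).aestronglyMeasurable
    simp only [Function.comp_apply, id, mul_ite, mul_one, mul_zero] at this
    rw [this]
    rw [integral_posterior_residual, zero_mul]
  have hi := integrable_fst_gaussian_prod τ₀ σ₀
  have hp := integrable_posteriorMean τ₀ σ₀ s
  rw [← sub_eq_zero, selectedMean, ← integral_sub (hint _ hi) (hint _ hp), ← hres]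
  refine integral_congr_ae (Eventually.of_forall fun p => ?_)
  dsimp only
  split_ifs <;> simp

lemma map_add_const_mul_gaussian_prod :
    ∃ v : NNReal, (v : ℝ) = σ₀ ^ 2 + s ^ 2 ∧
    ((gaussianReal τ₀ (σ₀ ^ 2).toNNReal).prod (gaussianReal 0 1)).map
      (fun p => p.1 + s * p.2) = gaussianReal τ₀ v := by
  have hind : IndepFun (fun p : ℝ × ℝ => p.1) (fun p : ℝ × ℝ => s * p.2)
      ((gaussianReal τ₀ (σ₀ ^ 2).toNNReal).prod (gaussianReal 0 1)) :=
    indepFun_prod (X := id) (Y := fun x => s * x) measurable_id (by fun_prop)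
  have hZ : ((gaussianReal τ₀ (σ₀ ^ 2).toNNReal).prod (gaussianReal 0 1)).map
      (fun p : ℝ × ℝ => s * p.2) = gaussianReal (s * 0) (.mk (s ^ 2) (sq_nonneg s) * 1) := by
    have hs : ((gaussianReal τ₀ (σ₀ ^ 2).toNNReal).prod (gaussianReal 0 1)).map
        (fun p : ℝ × ℝ => p.2) = gaussianReal 0 1 := Measure.map_snd_prod.trans (by simp)
    rw [← gaussianReal_map_const_mul]
    conv_rhs => rw [← hs, Measure.map_map (by fun_prop) (by fun_prop)]
    rfl
  have hX : ((gaussianReal τ₀ (σ₀ ^ 2).toNNReal).prod (gaussianReal 0 1)).map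
      (fun p : ℝ × ℝ => p.1) = gaussianReal τ₀ (σ₀ ^ 2).toNNReal :=
    Measure.map_fst_prod.trans (by simp)
  have hsum := gaussianReal_add_gaussianReal_of_indepFun hind hX hZ
  rw [mul_zero, add_zero] at hsum
  refine ⟨_, ?_, hsum⟩
  simp [sq_nonneg]

lemma measurable_posteriorMean : Measurable (posteriorMean τ₀ σ₀ s) := by
  unfold posteriorMean
  fun_prop

lemma posteriorMean_pos_iff (hσ₀ : 0 < σ₀) (u : ℝ) :
    0 < posteriorMean τ₀ σ₀ s u ↔ -(s ^ 2 * τ₀ / σ₀ ^ 2) < u := by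
  have h1 : 0 < σ₀ ^ 2 + s ^ 2 := by positivity
  have h2 : posteriorMean τ₀ σ₀ s u =
      σ₀ ^ 2 / (σ₀ ^ 2 + s ^ 2) * (u - -(s ^ 2 * τ₀ / σ₀ ^ 2)) := by
    unfold posteriorMean
    field_simp
    ring
  rw [h2, mul_pos_iff_of_pos_left (by positivity), sub_pos]

lemma posteriorMean_neg_iff (hσ₀ : 0 < σ₀) (u : ℝ) :
    posteriorMean τ₀ σ₀ s u < 0 ↔ u < -(s ^ 2 * τ₀ / σ₀ ^ 2) := by
  have h1 : 0 < σ₀ ^ 2 + s ^ 2 := by positivity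
  have h2 : posteriorMean τ₀ σ₀ s u =
      σ₀ ^ 2 / (σ₀ ^ 2 + s ^ 2) * (u - -(s ^ 2 * τ₀ / σ₀ ^ 2)) := by
    unfold posteriorMean
    field_simp
    ring
  rw [h2, ← neg_pos, ← mul_neg, mul_pos_iff_of_pos_left (by positivity), neg_pos, sub_neg]

/-- Selecting on a positive posterior mean is uniquely optimal among threshold rules. -/
lemma selectedMean_le_and_eq_iff (hσ₀ : 0 < σ₀) (h : ℝ) :
    selectedMean τ₀ σ₀ s h ≤ selectedMean τ₀ σ₀ s (-(s ^ 2 * τ₀ / σ₀ ^ 2)) ∧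
    (selectedMean τ₀ σ₀ s h = selectedMean τ₀ σ₀ s (-(s ^ 2 * τ₀ / σ₀ ^ 2)) →
      h = -(s ^ 2 * τ₀ / σ₀ ^ 2)) := by
  set h' := -(s ^ 2 * τ₀ / σ₀ ^ 2) with hh'
  set μ := (gaussianReal τ₀ (σ₀ ^ 2).toNNReal).prod (gaussianReal 0 1) with hμ
  have hint : ∀ x, Integrable (fun p : ℝ × ℝ => if x < p.1 + s * p.2 then
      posteriorMean τ₀ σ₀ s (p.1 + s * p.2) else 0) μ := fun x =>
    (integrable_posteriorMean τ₀ σ₀ s).indicator (s := {p : ℝ × ℝ | x < p.1 + s * p.2})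
      (measurableSet_lt (by fun_prop) (by fun_prop))
  -- The gain is the absolute posterior mean between the two thresholds and 0 elsewhere.
  let gain : ℝ → ℝ := fun u => (if h' < u then posteriorMean τ₀ σ₀ s u else 0)
    - (if h < u then posteriorMean τ₀ σ₀ s u else 0)
  have hgain : ∀ u, 0 ≤ gain u := fun u => by
    have h1 := posteriorMean_pos_iff τ₀ σ₀ s hσ₀ u
    simp only [gain]
    split_ifs with ha hb hb
    · simp
    · rw [sub_zero]; exact (h1.2 ha).le
    · rw [zero_sub, neg_nonneg]
      exact not_lt.1 fun hc => ha (h1.1 hc)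
    · simp
  have hdiff : selectedMean τ₀ σ₀ s h' - selectedMean τ₀ σ₀ s h =
      ∫ p : ℝ × ℝ, gain (p.1 + s * p.2) ∂μ := by
    rw [selectedMean_eq_integral_posteriorMean _ _ _ hσ₀,
      selectedMean_eq_integral_posteriorMean _ _ _ hσ₀, ← integral_sub (hint _) (hint _)]
  refine ⟨sub_nonneg.1 (hdiff ▸ integral_nonneg fun p => hgain _), fun heq => ?_⟩
  rw [heq, sub_self] at hdiff
  have hz := (integral_eq_zero_iff_of_nonneg (fun p => hgain _) ((hint h').sub (hint h))).1
    hdiff.symm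
  obtain ⟨v, hv, hlaw⟩ := map_add_const_mul_gaussian_prod τ₀ σ₀ s
  have hv0 : v ≠ 0 := fun h0 => by
    rw [h0] at hv
    have : 0 < σ₀ ^ 2 + s ^ 2 := by positivity
    simp only [NNReal.coe_zero] at hv
    linarith
  have hm : Measurable gain :=
    (Measurable.ite measurableSet_Ioi (measurable_posteriorMean _ _ _) measurable_const).sub
      (Measurable.ite measurableSet_Ioi (measurable_posteriorMean _ _ _) measurable_const)
  have hae : ∀ᵐ u ∂(gaussianReal τ₀ v), gain u = 0 := by
    rw [← hlaw]
    refine (ae_map_iff (by fun_prop) (measurableSet_eq_fun hm measurable_const)).2 ?_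
    filter_upwards [hz] with p hp using hp
  -- The observation has full support, so the gain vanishes on a dense set. An open interval between
  -- distinct thresholds would contain such a point, although the posterior mean is nonzero there.
  have hdense := Measure.dense_of_ae ((gaussianReal_absolutelyContinuous' τ₀ hv0).ae_le hae)
  rcases lt_trichotomy h h' with hlt | heq' | hgt
  · obtain ⟨u, hu, hu0⟩ := hdense.exists_mem_open isOpen_Ioo (Set.nonempty_Ioo.2 hlt)
    have := (posteriorMean_neg_iff τ₀ σ₀ s hσ₀ u).2 hu0.2
    simp only [Set.mem_ofPred_eq, gain, if_neg hu0.2.le.not_gt, if_pos hu0.1] at hu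
    linarith
  · exact heq'
  · obtain ⟨u, hu, hu0⟩ := hdense.exists_mem_open isOpen_Ioo (Set.nonempty_Ioo.2 hgt)
    have := (posteriorMean_pos_iff τ₀ σ₀ s hσ₀ u).2 hu0.1
    simp only [Set.mem_ofPred_eq, gain, if_neg hu0.2.le.not_gt, if_pos hu0.1] at hu
    linarith

end Posterior

/-- By symmetry and absence of atoms the distribution function is at most 1/2 at 0. The sign of the
critical value is needed for `β*` and its plug-in version to be nonnegative. -/
lemma normalQuantile_nonneg {p : ℝ} (hp : 1 / 2 < p) : 0 ≤ normalQuantile p := by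
  refine Real.sInf_nonneg fun x hx => ?_
  by_contra! hneg
  have h1 : cdf (gaussianReal 0 1) x ≤ cdf (gaussianReal 0 1) 0 := monotone_cdf _ hneg.le
  have h2 : cdf (gaussianReal 0 1) 0 ≤ 1 / 2 := by
    rw [cdf_eq_real]
    have hs : (gaussianReal 0 1).real (Set.Iic 0) = (gaussianReal 0 1).real (Set.Ioi 0) := by
      have hn : (gaussianReal 0 1).map (fun x => -x) = gaussianReal 0 1 := by
        rw [gaussianReal_map_neg, neg_zero]
      have := nullSingletonClass_gaussianReal (μ := 0) (v := 1) one_ne_zero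
      rw [measureReal_def, measureReal_def, ← measure_congr Iio_ae_eq_Iic]
      nth_rewrite 2 [← hn]
      rw [Measure.map_apply measurable_neg measurableSet_Ioi]
      congr 2
      ext y
      simp
    have := probReal_compl_eq_one_sub (μ := gaussianReal 0 1) (s := Set.Iic 0) measurableSet_Iic
    rw [Set.compl_Iic] at this
    linarith
  have hx' : p ≤ cdf (gaussianReal 0 1) x := hx
  linarith

/-! ### Moments of quadratic forms in Gaussian noise. -/

section GaussianVector

variable {n : ℕ} (v : NNReal)

lemma memLp_eval_pi_gaussianReal (i : Fin n) (p : ENNReal) (hp : p ≠ ⊤) :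
    MemLp (fun e : Fin n → ℝ => e i) p (Measure.pi fun _ => gaussianReal 0 v) :=
  (memLp_id_gaussianReal' p hp).comp_measurePreserving
    (measurePreserving_eval (fun _ : Fin n => gaussianReal 0 v) i)

lemma memLp_dotProduct_self_pi_gaussianReal :
    MemLp (fun e : Fin n → ℝ => e ⬝ᵥ e) 2 (Measure.pi fun _ => gaussianReal 0 v) := by
  simp only [dotProduct]
  refine memLp_finsetSum _ fun i _ => ?_
  rw [memLp_two_iff_integrable_sq (by fun_prop)]
  have := (memLp_eval_pi_gaussianReal v i 4 (by simp)).integrable_norm_pow (p := 4) (by norm_num)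
  refine this.congr (Eventually.of_forall fun e => ?_)
  simp only [Real.norm_eq_abs]
  rw [show (4 : ℕ) = 2 * 2 from rfl, pow_mul, sq_abs, sq (e i)]

lemma integrable_eval_mul_eval_pi_gaussianReal (i j : Fin n) :
    Integrable (fun e : Fin n → ℝ => e i * e j) (Measure.pi fun _ => gaussianReal 0 v) :=
  (memLp_eval_pi_gaussianReal v i 2 (by simp)).integrable_mul
    (memLp_eval_pi_gaussianReal v j 2 (by simp))

lemma integral_eval_mul_eval_pi_gaussianReal (i j : Fin n) :
    ∫ e : Fin n → ℝ, e i * e j ∂(Measure.pi fun _ => gaussianReal 0 v) =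
      if i = j then (v : ℝ) else 0 := by
  have hlaw : ∀ i : Fin n, HasLaw (fun e : Fin n → ℝ => e i) (gaussianReal 0 v)
      (Measure.pi fun _ => gaussianReal 0 v) := fun i =>
    ⟨(measurable_pi_apply i).aemeasurable,
      (measurePreserving_eval (fun _ : Fin n => gaussianReal 0 v) i).map_eq⟩
  have hmean : ∀ i : Fin n,
      ∫ e : Fin n → ℝ, e i ∂(Measure.pi fun _ => gaussianReal 0 v) = 0 := fun i => by
    rw [(hlaw i).integral_eq, integral_id_gaussianReal]
  split_ifs with h
  · subst h
    have := (hlaw i).variance_eq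
    rw [variance_id_gaussianReal, variance_eq_sub (memLp_eval_pi_gaussianReal v i 2 (by simp)),
      hmean] at this
    simpa [sq] using this
  · have hi : iIndepFun (fun (i : Fin n) (e : Fin n → ℝ) => e i)
        (Measure.pi fun _ => gaussianReal 0 v) :=
      iIndepFun_pi (X := fun _ x => x) fun i => by fun_prop
    rw [(hi.indepFun h).integral_fun_mul_eq_mul_integral
      (hlaw i).aemeasurable.aestronglyMeasurable (hlaw j).aemeasurable.aestronglyMeasurable, hmean,
      zero_mul]

/-- Off-diagonal terms of the quadratic form integrate to 0, leaving `v` times the trace of the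
projection. -/
lemma integral_olsNoiseVar_pi_gaussianReal {d : ℕ} (hN : d + 2 < n)
    {t : Matrix (Fin n) (Fin (d + 2)) ℝ} (ht : IsUnit (t.transpose * t).det) :
    ∫ e, olsNoiseVar t e ∂(Measure.pi fun _ => gaussianReal 0 v) = v := by
  have hpos : (0 : ℝ) < n - 2 - d := by
    have : ((d + 2 : ℕ) : ℝ) < n := Nat.cast_lt.2 hN
    push_cast at this
    linarith
  have hint := integrable_eval_mul_eval_pi_gaussianReal (n := n) v
  simp only [olsNoiseVar, olsResidual_dotProduct_self ht]
  have hint' : ∀ i, Integrable (fun e : Fin n → ℝ => ∑ j, residualMaker t i j * (e i * e j))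
      (Measure.pi fun _ => gaussianReal 0 v) := fun i =>
    integrable_finsetSum _ fun j _ => (hint i j).const_mul _
  rw [integral_const_mul, integral_finsetSum _ fun i _ => hint' i]
  have h : ∀ i, ∫ e : Fin n → ℝ, ∑ j, residualMaker t i j * (e i * e j)
      ∂(Measure.pi fun _ => gaussianReal 0 v) = residualMaker t i i * v := fun i => by
    rw [integral_finsetSum _ fun j _ => (hint i j).const_mul _]
    simp only [integral_const_mul, integral_eval_mul_eval_pi_gaussianReal]
    simp
  simp only [h]
  rw [← Finset.sum_mul]
  have := trace_residualMaker ht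
  rw [Matrix.trace] at this
  simp only [Matrix.diag] at this
  rw [this]
  field_simp

end GaussianVector

lemma olsNoiseVar_nonneg {n d : ℕ} (hN : d + 2 < n) (t : Matrix (Fin n) (Fin (d + 2)) ℝ)
    (e : Fin n → ℝ) : 0 ≤ olsNoiseVar t e := by
  have hpos : (0 : ℝ) < n - 2 - d := by
    have : ((d + 2 : ℕ) : ℝ) < n := Nat.cast_lt.2 hN
    push_cast at this
    linarith
  exact mul_nonneg (by positivity) (Finset.sum_nonneg fun i _ => mul_self_nonneg _)

/-- The law of `(τ, b, τ̂)` when `τ ∼ N(τ₀, σ₀²)`, `b ∼ ν` and `τ̂ - τ = (σ b / √N) Z` with an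
independent standard Gaussian variable `Z`. -/
def jointLaw (N : ℕ) (τ₀ σ₀ σ : ℝ) (ν : Measure ℝ) : Measure (ℝ × ℝ × ℝ) :=
  (((gaussianReal τ₀ (σ₀ ^ 2).toNNReal).prod ν).prod (gaussianReal 0 1)).map
    fun p => (p.1.1, p.1.2, p.1.1 + σ / √(N : ℝ) * p.1.2 * p.2)

/-! ### Independence and common law across experiments; consistency of `σ̂²`. -/

namespace Experiments

variable {Ω : Type*} [MeasurableSpace Ω] {P : Measure Ω} [IsProbabilityMeasure P] {N d : ℕ}
  {τ₀ σ₀ σ : ℝ} {E : Experiments Ω N d}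

/-- The triple `(τ_k, b_k, τ̂_k)`. -/
def obs (E : Experiments Ω N d) (k : ℕ) (ω : Ω) : ℝ × ℝ × ℝ := (E.τ k ω, E.b k ω, E.tauHat k ω)

namespace IsOLSModel

section
omit [IsProbabilityMeasure P]

lemma measurable_t (hE : E.IsOLSModel P τ₀ σ₀ σ) (k : ℕ) (i : Fin N) (j : Fin (d + 2)) :
    Measurable fun ω => E.t k ω i j :=
  measurable_designMatrix (hE.measurable_D k) (hE.measurable_X k) i j

lemma measurable_Y (hE : E.IsOLSModel P τ₀ σ₀ σ) (k : ℕ) : Measurable (E.Y k) := by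
  have h1 := hE.measurable_a k
  have h2 := hE.measurable_τ k
  have h3 := hE.measurable_θ k
  have h4 := hE.measurable_D k
  have h5 := hE.measurable_X k
  have h6 := hE.measurable_ε k
  refine measurable_pi_lambda _ fun i => ?_
  simp only [Y, dotProduct]
  fun_prop

lemma measurable_b (hE : E.IsOLSModel P τ₀ σ₀ σ) (k : ℕ) : Measurable (E.b k) :=
  measurable_designScale (hE.measurable_t k)

lemma measurable_tauHat (hE : E.IsOLSModel P τ₀ σ₀ σ) (k : ℕ) : Measurable (E.tauHat k) :=
  measurable_olsEffect (hE.measurable_t k) (hE.measurable_Y k)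

lemma measurable_sSq (hE : E.IsOLSModel P τ₀ σ₀ σ) (k : ℕ) : Measurable (E.sSq k) :=
  measurable_olsNoiseVar (hE.measurable_t k) (hE.measurable_Y k)

lemma measurable_obs (hE : E.IsOLSModel P τ₀ σ₀ σ) (k : ℕ) : Measurable (E.obs k) :=
  (hE.measurable_τ k).prodMk ((hE.measurable_b k).prodMk (hE.measurable_tauHat k))

lemma ae_tauHat_eq (hE : E.IsOLSModel P τ₀ σ₀ σ) (k : ℕ) :
    ∀ᵐ ω ∂P, E.tauHat k ω = E.τ k ω + treatWeight (E.t k ω) ⬝ᵥ E.ε k ω := by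
  filter_upwards [hE.nonsingular k] with ω hω
  have hY : E.Y k ω = _ := outcome_eq_mulVec _ _ _ _ _ _
  rw [tauHat, hY]
  exact olsEffect_mulVec_add hω _ _

lemma ae_sSq_eq (hE : E.IsOLSModel P τ₀ σ₀ σ) (k : ℕ) :
    ∀ᵐ ω ∂P, E.sSq k ω = olsNoiseVar (E.t k ω) (E.ε k ω) := by
  filter_upwards [hE.nonsingular k] with ω hω
  have hY : E.Y k ω = _ := outcome_eq_mulVec _ _ _ _ _ _
  rw [sSq, hY]
  exact olsNoiseVar_mulVec_add hω _ _

lemma ae_b_pos (hE : E.IsOLSModel P τ₀ σ₀ σ) (hN : 0 < N) (k : ℕ) :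
    ∀ᵐ ω ∂P, 0 < E.b k ω := by
  filter_upwards [hE.nonsingular k] with ω hω using designScale_pos hN hω

lemma pairwise_indepFun_obs (hE : E.IsOLSModel P τ₀ σ₀ σ) :
    Pairwise fun i j => IndepFun (E.obs i) (E.obs j) P := by
  intro i j hij
  -- Intercepts and covariate coefficients do not enter `f`, so their possible dependence across
  -- experiments is harmless.
  let f : ℝ × ((Fin N → ℝ) × (Fin N → Fin d → ℝ)) × (Fin N → ℝ) → ℝ × ℝ × ℝ := fun u =>
    (u.1, designScale (designMatrix u.2.1.1 u.2.1.2),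
      u.1 + treatWeight (designMatrix u.2.1.1 u.2.1.2) ⬝ᵥ u.2.2)
  have hf : Measurable f := by
    have hd : ∀ i j, Measurable fun u : ℝ × ((Fin N → ℝ) × (Fin N → Fin d → ℝ)) × (Fin N → ℝ) =>
        designMatrix u.2.1.1 u.2.1.2 i j :=
      measurable_designMatrix (by fun_prop) (by fun_prop)
    have h1 := measurable_treatWeight hd
    refine measurable_fst.prodMk ((measurable_designScale hd).prodMk (measurable_fst.add ?_))
    simp only [dotProduct]
    fun_prop
  have h := (hE.indep_experiments.indepFun hij).comp hf hf
  refine h.congr ?_ ?_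
  · filter_upwards [hE.ae_tauHat_eq i] with ω hω
    simp [obs, f, hω, b, t]
  · filter_upwards [hE.ae_tauHat_eq j] with ω hω
    simp [obs, f, hω, b, t]

lemma pairwise_indepFun_sSq (hE : E.IsOLSModel P τ₀ σ₀ σ) :
    Pairwise fun i j => IndepFun (E.sSq i) (E.sSq j) P := by
  intro i j hij
  let f : ℝ × ((Fin N → ℝ) × (Fin N → Fin d → ℝ)) × (Fin N → ℝ) → ℝ := fun u =>
    olsNoiseVar (designMatrix u.2.1.1 u.2.1.2) u.2.2
  have hf : Measurable f :=
    measurable_olsNoiseVar (measurable_designMatrix (by fun_prop) (by fun_prop)) (by fun_prop)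
  have h := (hE.indep_experiments.indepFun hij).comp hf hf
  refine h.congr ?_ ?_
  · filter_upwards [hE.ae_sSq_eq i] with ω hω
    simp [f, hω, t]
  · filter_upwards [hE.ae_sSq_eq j] with ω hω
    simp [f, hω, t]

lemma ae_sSq_nonneg_le (hE : E.IsOLSModel P τ₀ σ₀ σ) (hN : d + 2 < N) (k : ℕ) :
    ∀ᵐ ω ∂P, 0 ≤ E.sSq k ω ∧
      E.sSq k ω ≤ 1 / ((N : ℝ) - 2 - d) * (E.ε k ω ⬝ᵥ E.ε k ω) := by
  have hpos : (0 : ℝ) < N - 2 - d := by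
    have : ((d + 2 : ℕ) : ℝ) < N := Nat.cast_lt.2 hN
    push_cast at this
    linarith
  filter_upwards [hE.nonsingular k, hE.ae_sSq_eq k] with ω h1 h2
  refine ⟨olsNoiseVar_nonneg hN _ _, ?_⟩
  rw [h2, olsNoiseVar]
  exact mul_le_mul_of_nonneg_left (olsResidual_dotProduct_self_le h1 _) (by positivity)

end

lemma map_ε (hE : E.IsOLSModel P τ₀ σ₀ σ) (k : ℕ) :
    P.map (E.ε k) = Measure.pi fun _ => gaussianReal 0 (σ ^ 2).toNNReal := by
  have h := hE.measurable_ε k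
  have := (iIndepFun_iff_map_fun_eq_pi_map fun i => by fun_prop).1 (hE.indep_ε k)
  simp only [hE.law_ε] at this
  exact this

/-- The design acts on `τ̂_k - τ_k` only through the length of the weight vector, that is through
`b_k`. Independence of `b_k` and `τ_k` then makes the law of the triple the same for all `k`. -/
lemma map_obs (hE : E.IsOLSModel P τ₀ σ₀ σ) (hN : 0 < N) (k : ℕ) :
    P.map (E.obs k) = jointLaw N τ₀ σ₀ σ (P.map (E.b 0)) := by
  have hmτ := hE.measurable_τ k
  have hmD := hE.measurable_D k
  have hmX := hE.measurable_X k
  have hmε := hE.measurable_ε k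
  have hmb := hE.measurable_b k
  have hd : ∀ i j, Measurable fun u : ℝ × (Fin N → ℝ) × (Fin N → Fin d → ℝ) =>
      designMatrix u.2.1 u.2.2 i j := measurable_designMatrix (by fun_prop) (by fun_prop)
  have hw := measurable_treatWeight hd
  have hb := measurable_designScale hd
  have hNpos : (0 : ℝ) < N := Nat.cast_pos.2 hN
  -- `τ` is kept in the conditioning variable, so that the standardized noise comes out independent
  -- of effect and design jointly.
  let U : Ω → ℝ × (Fin N → ℝ) × (Fin N → Fin d → ℝ) := fun ω => (E.τ k ω, (E.D k ω, E.X k ω))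
  have hU : Measurable U := by fun_prop
  have hmix := map_prodMk_dotProduct_of_indepFun (P := P) (U := U) (e := E.ε k)
    (v := (σ ^ 2).toNNReal) hU hmε
    (hE.map_ε k) (hE.indep_noise k).symm hw (c := fun u => σ / √(N : ℝ) *
      designScale (designMatrix u.2.1 u.2.2)) (hb.const_mul _) (by
        filter_upwards [hE.nonsingular k] with ω hω
        have hb2 := designScale_sq hω
        simp only [t] at hb2
        rw [mul_pow, hb2, div_pow, Real.sq_sqrt hNpos.le,
          Real.coe_toNNReal _ (sq_nonneg _)]
        simp only [U]
        field_simp)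
  have h1 : E.obs k =ᵐ[P] (fun q : (ℝ × (Fin N → ℝ) × (Fin N → Fin d → ℝ)) × ℝ =>
      (q.1.1, designScale (designMatrix q.1.2.1 q.1.2.2), q.1.1 + q.2)) ∘
      (fun ω => (U ω, treatWeight (designMatrix (U ω).2.1 (U ω).2.2) ⬝ᵥ E.ε k ω)) := by
    filter_upwards [hE.ae_tauHat_eq k] with ω hω
    simp [obs, hω, b, t, U]
  have hb' : Measurable fun q : (ℝ × (Fin N → ℝ) × (Fin N → Fin d → ℝ)) × ℝ =>
      designScale (designMatrix q.1.2.1 q.1.2.2) := hb.comp measurable_fst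
  have hout : Measurable fun q : (ℝ × (Fin N → ℝ) × (Fin N → Fin d → ℝ)) × ℝ =>
      (q.1.1, designScale (designMatrix q.1.2.1 q.1.2.2), q.1.1 + q.2) := by
    fun_prop
  have hdot : Measurable fun ω =>
      (U ω, treatWeight (designMatrix (U ω).2.1 (U ω).2.2) ⬝ᵥ E.ε k ω) := by
    have := hw.comp hU
    simp only [Function.comp_def] at this
    simp only [dotProduct]
    fun_prop
  have hτb : P.map (fun ω => (E.τ k ω, E.b k ω)) =
      (gaussianReal τ₀ (σ₀ ^ 2).toNNReal).prod (P.map (E.b 0)) := by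
    rw [(hE.indep_b_τ k).symm.map_prod_eq_prod_map_map hmτ.aemeasurable hmb.aemeasurable,
      hE.law_τ, (hE.identDistrib_b k).map_eq]
  have hred : Measurable fun u : ℝ × (Fin N → ℝ) × (Fin N → Fin d → ℝ) =>
      (u.1, designScale (designMatrix u.2.1 u.2.2)) := by fun_prop
  have hscale : Measurable fun p : (ℝ × (Fin N → ℝ) × (Fin N → Fin d → ℝ)) × ℝ =>
      (p.1, σ / √(N : ℝ) * designScale (designMatrix p.1.2.1 p.1.2.2) * p.2) :=
    measurable_fst.prodMk ((hb'.const_mul _).mul measurable_snd)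
  rw [jointLaw, ← hτb, Measure.map_congr h1, ← Measure.map_map hout hdot, hmix,
    Measure.map_map hout hscale]
  have : P.map (fun ω => (E.τ k ω, E.b k ω)) = (P.map U).map
      (fun u => (u.1, designScale (designMatrix u.2.1 u.2.2))) := by
    rw [Measure.map_map hred hU]
    rfl
  rw [this]
  have hprod := Measure.map_prod_map (P.map U) (gaussianReal 0 1) hred measurable_id
  rw [Measure.map_id] at hprod
  rw [hprod, Measure.map_map (by fun_prop) (by fun_prop)]
  rfl

lemma identDistrib_obs (hE : E.IsOLSModel P τ₀ σ₀ σ) (hN : 0 < N) (k : ℕ) :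
    IdentDistrib (E.obs k) (E.obs 0) P P :=
  ⟨(hE.measurable_obs k).aemeasurable, (hE.measurable_obs 0).aemeasurable, by
    rw [hE.map_obs hN, hE.map_obs hN]⟩

lemma memLp_noise_bound (hE : E.IsOLSModel P τ₀ σ₀ σ) (k : ℕ) :
    MemLp (fun ω => 1 / ((N : ℝ) - 2 - d) * (E.ε k ω ⬝ᵥ E.ε k ω)) 2 P := by
  have h := memLp_dotProduct_self_pi_gaussianReal (n := N) (σ ^ 2).toNNReal
  rw [← hE.map_ε k] at h
  exact (h.comp_of_map (hE.measurable_ε k).aemeasurable).const_mul _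

lemma memLp_sSq (hE : E.IsOLSModel P τ₀ σ₀ σ) (hN : d + 2 < N) (k : ℕ) :
    MemLp (E.sSq k) 2 P := by
  refine (hE.memLp_noise_bound k).mono (hE.measurable_sSq k).aestronglyMeasurable ?_
  filter_upwards [hE.ae_sSq_nonneg_le hN k] with ω hω
  rw [Real.norm_of_nonneg hω.1, Real.norm_of_nonneg (hω.1.trans hω.2)]
  exact hω.2

/-- Conditionally on almost every design the mean is already `σ²`; Fubini removes the conditioning.
-/
lemma integral_sSq (hE : E.IsOLSModel P τ₀ σ₀ σ) (hN : d + 2 < N) (k : ℕ) :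
    ∫ ω, E.sSq k ω ∂P = σ ^ 2 := by
  have hmD := hE.measurable_D k
  have hmX := hE.measurable_X k
  have hmε := hE.measurable_ε k
  let U : Ω → (Fin N → ℝ) × (Fin N → Fin d → ℝ) := fun ω => (E.D k ω, E.X k ω)
  have hU : Measurable U := by fun_prop
  have hind : IndepFun U (E.ε k) P :=
    (hE.indep_noise k).symm.comp measurable_snd measurable_id
  have hd : ∀ i j, Measurable fun u : (Fin N → ℝ) × (Fin N → Fin d → ℝ) =>
      designMatrix u.1 u.2 i j := measurable_designMatrix measurable_fst measurable_snd
  have hq : Measurable fun p : ((Fin N → ℝ) × (Fin N → Fin d → ℝ)) × (Fin N → ℝ) =>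
      olsNoiseVar (designMatrix p.1.1 p.1.2) p.2 :=
    measurable_olsNoiseVar (measurable_designMatrix (by fun_prop) (by fun_prop)) (by fun_prop)
  have hUε : Measurable fun ω => (U ω, E.ε k ω) := hU.prodMk hmε
  have hmap := hind.map_prod_eq_prod_map_map hU.aemeasurable hmε.aemeasurable
  rw [hE.map_ε k] at hmap
  have hint : Integrable (fun p : ((Fin N → ℝ) × (Fin N → Fin d → ℝ)) × (Fin N → ℝ) =>
      olsNoiseVar (designMatrix p.1.1 p.1.2) p.2)
      ((P.map U).prod (Measure.pi fun _ => gaussianReal 0 (σ ^ 2).toNNReal)) := by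
    rw [← hmap, integrable_map_measure hq.aestronglyMeasurable hUε.aemeasurable]
    exact ((hE.memLp_sSq hN k).integrable (by norm_num)).congr (hE.ae_sSq_eq k)
  rw [integral_congr_ae (hE.ae_sSq_eq k)]
  have h1 : ∫ ω, olsNoiseVar (E.t k ω) (E.ε k ω) ∂P =
      ∫ p, olsNoiseVar (designMatrix p.1.1 p.1.2) p.2 ∂(P.map fun ω => (U ω, E.ε k ω)) :=
    (integral_map hUε.aemeasurable hq.aestronglyMeasurable).symm
  rw [h1, hmap, integral_prod _ hint]
  have hae : ∀ᵐ u ∂(P.map U), ∫ e, olsNoiseVar (designMatrix u.1 u.2) e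
      ∂(Measure.pi fun _ => gaussianReal 0 (σ ^ 2).toNNReal) = σ ^ 2 := by
    have hset : MeasurableSet {u : (Fin N → ℝ) × (Fin N → Fin d → ℝ) |
        IsUnit ((designMatrix u.1 u.2).transpose * designMatrix u.1 u.2).det} := by
      simp only [isUnit_iff_ne_zero]
      refine (measurableSet_eq_fun (measurable_matrix_det fun i j => ?_) measurable_const).compl
      simp only [Matrix.mul_apply, Matrix.transpose_apply]
      exact Finset.measurable_sum _ fun l _ => (hd _ _).mul (hd _ _)
    filter_upwards [(ae_map_iff hU.aemeasurable hset).2 (hE.nonsingular k)] with u hu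
    rw [integral_olsNoiseVar_pi_gaussianReal _ hN hu, Real.coe_toNNReal _ (sq_nonneg _)]
  have : IsProbabilityMeasure (P.map U) := Measure.isProbabilityMeasure_map hU.aemeasurable
  rw [integral_congr_ae hae]
  simp

/-- Consistency of the pooled noise variance. -/
lemma tendstoInMeasure_sigmaHatSq (hE : E.IsOLSModel P τ₀ σ₀ σ) (hN : d + 2 < N) :
    TendstoInMeasure P (fun K ω => E.sigmaHatSq K ω) atTop (fun _ => σ ^ 2) := by
  refine tendstoInMeasure_avg_of_sq_le (hE.memLp_sSq hN) hE.pairwise_indepFun_sSq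
    (hE.integral_sSq hN) (C := ∫ e : Fin N → ℝ, (1 / ((N : ℝ) - 2 - d) * (e ⬝ᵥ e)) ^ 2
      ∂(Measure.pi fun _ => gaussianReal 0 (σ ^ 2).toNNReal)) fun k => ?_
  have hdot : Measurable fun e : Fin N → ℝ => (1 / ((N : ℝ) - 2 - d) * (e ⬝ᵥ e)) ^ 2 := by
    simp only [dotProduct]
    fun_prop
  rw [← hE.map_ε k, integral_map (hE.measurable_ε k).aemeasurable hdot.aestronglyMeasurable]
  refine integral_mono_ae (hE.memLp_sSq hN k).integrable_sq
    (hE.memLp_noise_bound k).integrable_sq ?_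
  filter_upwards [hE.ae_sSq_nonneg_le hN k] with ω hω
  exact pow_le_pow_left₀ hω.1 hω.2 2

end IsOLSModel

end Experiments

/-! ### Deterministic facts about averages and thresholds. -/

section Deterministic

open Experiments

lemma avg_sub_mean_sq {K : ℕ} (hK : 0 < K) (f : ℕ → ℝ) :
    (avg K fun k => (f k - avg K f) ^ 2) = (avg K fun k => f k ^ 2) - avg K f ^ 2 := by
  have hK' : (K : ℝ) ≠ 0 := Nat.cast_ne_zero.2 hK.ne'
  have h1 : ∀ k, (f k - avg K f) ^ 2 = f k ^ 2 - 2 * avg K f * f k + avg K f ^ 2 := fun k => by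
    ring
  have h2 : ∑ k ∈ Finset.range K, f k = K * avg K f := by
    rw [avg]
    field_simp
  set m := avg K f
  simp only [avg, h1, Finset.sum_add_distrib, Finset.sum_sub_distrib, ← Finset.mul_sum, h2,
    Finset.sum_const, Finset.card_range, nsmul_eq_mul]
  field_simp
  ring

lemma abs_avg_sub_avg_le {K : ℕ} {f g h : ℕ → ℝ} (hfg : ∀ k, |f k - g k| ≤ h k) :
    |avg K f - avg K g| ≤ avg K h := by
  simp only [avg]
  rw [← mul_sub, ← Finset.sum_sub_distrib, abs_mul, abs_of_nonneg (by positivity)]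
  gcongr
  exact (Finset.abs_sum_le_sum_abs _ _).trans (Finset.sum_le_sum fun k _ => hfg k)

/-- Averages over the units passing a threshold are continuous in the threshold, if the units
close to the limiting threshold have a small contribution. -/
lemma tendsto_avg_threshold {T B H : ℕ → ℝ} {c R : ℝ} {e : ℕ → ℝ} {ns : ℕ → ℕ} {cs : ℕ → ℝ}
    (h1 : Tendsto (fun K => avg K fun k => if -(c * B k ^ 2) < H k then T k else 0) atTop (𝓝 R))
    (h2 : ∀ m : ℕ, Tendsto (fun K => avg K fun k =>
      if |H k + c * B k ^ 2| ≤ 1 / ((m : ℝ) + 1) * B k ^ 2 then |T k| else 0) atTop (𝓝 (e m)))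
    (he : Tendsto e atTop (𝓝 0)) (hns : Tendsto ns atTop atTop) (hcs : Tendsto cs atTop (𝓝 c)) :
    Tendsto (fun i => avg (ns i) fun k => if -(cs i * B k ^ 2) < H k then T k else 0)
      atTop (𝓝 R) := by
  have hdiff : Tendsto (fun i => (avg (ns i) fun k => if -(cs i * B k ^ 2) < H k then T k else 0)
      - avg (ns i) fun k => if -(c * B k ^ 2) < H k then T k else 0) atTop (𝓝 0) := by
    rw [Metric.tendsto_nhds]
    intro δ hδ
    obtain ⟨m, hm⟩ := (he.eventually (gt_mem_nhds hδ)).exists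
    have hm0 : (0 : ℝ) < 1 / ((m : ℝ) + 1) := by positivity
    filter_upwards [((h2 m).comp hns).eventually (gt_mem_nhds hm),
      hcs.eventually (Metric.closedBall_mem_nhds c hm0)] with i hi hci
    rw [Real.dist_eq, sub_zero]
    refine lt_of_le_of_lt (abs_avg_sub_avg_le fun k => ?_) hi
    have hci' : |cs i - c| ≤ 1 / ((m : ℝ) + 1) := by rwa [← Real.dist_eq]
    have hcB : |cs i * B k ^ 2 - c * B k ^ 2| ≤ 1 / ((m : ℝ) + 1) * B k ^ 2 := by
      rw [← sub_mul, abs_mul, abs_of_nonneg (sq_nonneg (B k))]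
      gcongr
    have hcB' := abs_le.1 hcB
    -- If the two rules disagree on unit `k`, then `H k` lies between their thresholds, which are at
    -- most `B k ^ 2 / (m + 1)` apart.
    have key : ¬(-(cs i * B k ^ 2) < H k ↔ -(c * B k ^ 2) < H k) →
        |H k + c * B k ^ 2| ≤ 1 / ((m : ℝ) + 1) * B k ^ 2 := fun hne => by
      rw [abs_le]
      by_cases ha : -(cs i * B k ^ 2) < H k
      · have hb : ¬ -(c * B k ^ 2) < H k := fun hb => hne ⟨fun _ => hb, fun _ => ha⟩
        constructor <;> linarith
      · have hb : -(c * B k ^ 2) < H k := by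
          by_contra hb
          exact hne ⟨fun h => absurd h ha, fun h => absurd h hb⟩
        constructor <;> linarith
    by_cases hiff : (-(cs i * B k ^ 2) < H k ↔ -(c * B k ^ 2) < H k)
    · simp only [hiff, sub_self, abs_zero]
      split_ifs <;> simp
    · rw [if_pos (key hiff)]
      split_ifs <;> simp
  simpa using hdiff.add (h1.comp hns)

/-- After division by `N / (N + β)` the scale and the anchor only shift the threshold for the raw
estimate. -/
lemma decision_iff {N β s b z τ H : ℝ} (hN : 0 < N) (hβ : 0 < N + β) :
    N / (N + β) * (s * b / √N) * z < N / (N + β) * H + β / (N + β) * τ ↔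
      s * b / √N * z - β * τ / N < H := by
  have h1 : N / (N + β) * (s * b / √N) * z = N / (N + β) * (s * b / √N * z) := by ring
  have h2 : N / (N + β) * H + β / (N + β) * τ = N / (N + β) * (H + β * τ / N) := by
    field_simp
  rw [h1, h2, mul_lt_mul_iff_right₀ (by positivity), sub_lt_iff_lt_add]

/-- The second summand of the scale, times `τ / N`, is exactly the critical-value term. Since `A`,
`s` and `τ` are free, the identity serves both `β*` and its plug-in version. -/
lemma threshold_cancel {N : ℝ} (hN : 0 < N) (A s b z τ : ℝ) (hτ : τ ≠ 0) :
    s * b / √N * z - (A * b ^ 2 + z * b * (√N * s) / τ) * τ / N = -(A * τ / N * b ^ 2) := by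
  have hs : √N * √N = N := Real.mul_self_sqrt hN.le
  have hs0 : √N ≠ 0 := (Real.sqrt_pos.2 hN).ne'
  have : s * b / √N * z = s * b * √N * z / N := by
    rw [div_mul_eq_mul_div, div_eq_div_iff hs0 hN.ne']
    calc s * b * z * N = s * b * z * (√N * √N) := by rw [hs]
      _ = _ := by ring
  rw [this]
  field_simp
  ring

end Deterministic

/-! ### The plug-in rule along a fixed sample path. -/

namespace Experiments

variable {Ω : Type*} {N d : ℕ}

/-- The ratio `σ̂² / σ̂₀²` of the pooled noise variance to the implied effect variance. -/
def varianceRatio (E : Experiments Ω N d) (K : ℕ) (ω : Ω) : ℝ :=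
  E.sigmaHatSq K ω / ((avg K fun k => (E.tauHat k ω - E.tauHat0 K ω) ^ 2)
        - (1 / (N : ℝ)) * (E.sigmaHatSq K ω * avg K fun k => (E.b k ω) ^ 2))

lemma betaHat_eq (E : Experiments Ω N d) (z : ℝ) (K : ℕ) (ω : Ω) (x : ℝ) :
    E.betaHat z K ω x = E.varianceRatio K ω * x ^ 2 +
      z * x * (√(N : ℝ) * E.sigmaHat K ω) / E.tauHat0 K ω := by
  rw [betaHat, varianceRatio, sigmaHat, Real.sqrt_mul (Nat.cast_nonneg N)]
  ring

lemma reward_eq_avg (E : Experiments Ω N d) (z s : ℝ) (β : ℝ → ℝ) (τ : ℝ) (K : ℕ) (ω : Ω) :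
    E.reward z s β τ K ω = avg K fun k =>
      if (N : ℝ) / ((N : ℝ) + β (E.b k ω)) * (s * E.b k ω / √(N : ℝ)) * z
        < shrink N (β (E.b k ω)) τ (E.tauHat k ω) then E.τ k ω else 0 := by
  rw [reward, avg, Finset.sum_filter]

lemma reward_eq_avg_threshold (E : Experiments Ω N d) (hN : 0 < N) {z s : ℝ} {β : ℝ → ℝ} {τ : ℝ}
    {K : ℕ} {ω : Ω} (hβ : ∀ k, 0 ≤ β (E.b k ω)) :
    E.reward z s β τ K ω = avg K fun k =>
      if s * E.b k ω / √(N : ℝ) * z - β (E.b k ω) * τ / N < E.tauHat k ω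
        then E.τ k ω else 0 := by
  have hN' : (0 : ℝ) < N := Nat.cast_pos.2 hN
  rw [reward_eq_avg]
  congr 1
  funext k
  have := hβ k
  simp only [shrink, decision_iff hN' (by linarith : (0 : ℝ) < N + β (E.b k ω))]

/-- At nonnegative pooled statistics the data-driven rule compares `τ̂_k` with a multiple of
`b_k²`: the contributions of the critical value cancel. -/
lemma reward_betaHat_eq (E : Experiments Ω N d) (hN : 0 < N) {z : ℝ} (hz : 0 ≤ z) {K : ℕ} {ω : Ω}
    (hb : ∀ k, 0 < E.b k ω) (hA : 0 ≤ E.varianceRatio K ω) (hτ : 0 < E.tauHat0 K ω) :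
    E.reward z (E.sigmaHat K ω) (E.betaHat z K ω) (E.tauHat0 K ω) K ω = avg K fun k =>
      if -(E.varianceRatio K ω * E.tauHat0 K ω / N * E.b k ω ^ 2) < E.tauHat k ω
        then E.τ k ω else 0 := by
  have hN' : (0 : ℝ) < N := Nat.cast_pos.2 hN
  rw [E.reward_eq_avg_threshold hN fun k => ?_]
  · simp only [betaHat_eq, threshold_cancel hN' _ _ _ _ _ hτ.ne']
  · rw [betaHat_eq]
    have := hb k
    have : 0 ≤ E.sigmaHat K ω := Real.sqrt_nonneg _
    positivity

/-- The empirical variance of the estimates tends to `σ₀² + σ² m / N`; the correction in the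
denominator removes the noise part. -/
lemma tendsto_varianceRatio (E : Experiments Ω N d) {τ₀ σ₀ σ m : ℝ} (hσ₀ : 0 < σ₀) {ω : Ω}
    {ns : ℕ → ℕ} (hns : Tendsto ns atTop atTop)
    (hH : Tendsto (fun K => E.tauHat0 K ω) atTop (𝓝 τ₀))
    (hH2 : Tendsto (fun K => avg K fun k => E.tauHat k ω ^ 2) atTop
      (𝓝 (τ₀ ^ 2 + σ₀ ^ 2 + σ ^ 2 / N * m)))
    (hb : Tendsto (fun K => avg K fun k => E.b k ω ^ 2) atTop (𝓝 m))
    (hs : Tendsto (fun i => E.sigmaHatSq (ns i) ω) atTop (𝓝 (σ ^ 2))) :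
    Tendsto (fun i => E.varianceRatio (ns i) ω) atTop (𝓝 (σ ^ 2 / σ₀ ^ 2)) := by
  have hlim : τ₀ ^ 2 + σ₀ ^ 2 + σ ^ 2 / N * m - τ₀ ^ 2 - 1 / (N : ℝ) * (σ ^ 2 * m) = σ₀ ^ 2 := by
    ring
  have hden := ((hH2.comp hns).sub ((hH.comp hns).pow 2)).sub
    ((hs.mul (hb.comp hns)).const_mul (1 / (N : ℝ)))
  rw [hlim] at hden
  refine (hs.div hden (by positivity)).congr' ?_
  filter_upwards [hns.eventually_gt_atTop 0] with i hi
  have := avg_sub_mean_sq hi fun k => E.tauHat k ω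
  simp only [varianceRatio, tauHat0, this, Function.comp_apply, Pi.div_apply]

lemma tendsto_betaHat (E : Experiments Ω N d) {τ₀ σ₀ σ : ℝ} (hτ₀ : 0 < τ₀) (hσ : 0 < σ) (z x : ℝ)
    {ω : Ω} {ns : ℕ → ℕ} (hH : Tendsto (fun i => E.tauHat0 (ns i) ω) atTop (𝓝 τ₀))
    (hA : Tendsto (fun i => E.varianceRatio (ns i) ω) atTop (𝓝 (σ ^ 2 / σ₀ ^ 2)))
    (hs : Tendsto (fun i => E.sigmaHatSq (ns i) ω) atTop (𝓝 (σ ^ 2))) :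
    Tendsto (fun i => E.betaHat z (ns i) ω x) atTop (𝓝 (betaStar N τ₀ σ₀ σ z x)) := by
  have hsig : Tendsto (fun i => E.sigmaHat (ns i) ω) atTop (𝓝 σ) := by
    have := (Real.continuous_sqrt.tendsto _).comp hs
    rwa [Real.sqrt_sq hσ.le] at this
  simp only [betaHat_eq]
  have := (hA.mul_const (x ^ 2)).add
    (((hsig.const_mul √(N : ℝ)).const_mul (z * x)).div hH hτ₀.ne')
  have hlim : σ ^ 2 / σ₀ ^ 2 * x ^ 2 + z * x * (√(N : ℝ) * σ) / τ₀ =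
      betaStar N τ₀ σ₀ σ z x := by
    unfold betaStar
    ring
  rw [← hlim]
  exact this

namespace IsOLSModel

variable [MeasurableSpace Ω] {P : Measure Ω} {τ₀ σ₀ σ : ℝ} {E : Experiments Ω N d}

lemma measurable_tauHat0 (hE : E.IsOLSModel P τ₀ σ₀ σ) (K : ℕ) : Measurable (E.tauHat0 K) :=
  (Finset.measurable_sum _ fun k _ => hE.measurable_tauHat k).const_mul _

lemma measurable_sigmaHatSq (hE : E.IsOLSModel P τ₀ σ₀ σ) (K : ℕ) :
    Measurable (E.sigmaHatSq K) :=
  (Finset.measurable_sum _ fun k _ => hE.measurable_sSq k).const_mul _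

lemma measurable_betaHat_comp (hE : E.IsOLSModel P τ₀ σ₀ σ) (z : ℝ) (K : ℕ) {x : Ω → ℝ}
    (hx : Measurable x) : Measurable fun ω => E.betaHat z K ω (x ω) := by
  have h1 := hE.measurable_tauHat0 K
  have h2 := hE.measurable_sigmaHatSq K
  have h3 := hE.measurable_tauHat
  have h4 := hE.measurable_b
  simp only [betaHat, avg]
  fun_prop

lemma measurable_reward_betaHat (hE : E.IsOLSModel P τ₀ σ₀ σ) (z : ℝ) (K : ℕ) :
    Measurable fun ω =>
      E.reward z (E.sigmaHat K ω) (E.betaHat z K ω) (E.tauHat0 K ω) K ω := by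
  have h1 := hE.measurable_tauHat0 K
  have h2 := hE.measurable_sigmaHatSq K
  have h3 := hE.measurable_tauHat
  have h4 := hE.measurable_b
  have h5 := fun k => hE.measurable_betaHat_comp z K (h4 k)
  simp only [reward_eq_avg, avg, shrink, sigmaHat]
  refine (Finset.measurable_sum _ fun k _ => Measurable.ite (measurableSet_lt ?_ ?_)
    (hE.measurable_τ k) measurable_const).const_mul _
  · fun_prop
  · fun_prop

end IsOLSModel

end Experiments

/-! ### Integrals under the common law of effect, design scale and estimate. -/

section JointLaw

variable {N : ℕ} (τ₀ σ₀ σ : ℝ) (ν : Measure ℝ) [IsProbabilityMeasure ν]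

lemma integrable_fst_gaussian_triple :
    Integrable (fun p : (ℝ × ℝ) × ℝ => p.1.1)
      (((gaussianReal τ₀ (σ₀ ^ 2).toNNReal).prod ν).prod (gaussianReal 0 1)) :=
  (((memLp_id_gaussianReal' (μ := τ₀) (v := (σ₀ ^ 2).toNNReal) 1 (by simp)).integrable
    le_rfl).comp_fst ν).comp_fst _

lemma integrable_threshold_triple {h : ℝ → ℝ} (hh : Measurable h) (c : ℝ) :
    Integrable (fun p : (ℝ × ℝ) × ℝ => if h p.1.2 < p.1.1 + c * p.1.2 * p.2 then p.1.1 else 0)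
      (((gaussianReal τ₀ (σ₀ ^ 2).toNNReal).prod ν).prod (gaussianReal 0 1)) :=
  (integrable_fst_gaussian_triple τ₀ σ₀ ν).indicator
    (s := {p : (ℝ × ℝ) × ℝ | h p.1.2 < p.1.1 + c * p.1.2 * p.2})
    (measurableSet_lt (by fun_prop) (by fun_prop))

lemma integral_integral_threshold (h c b : ℝ) :
    ∫ t, ∫ y, (if h < t + c * b * y then t else 0) ∂(gaussianReal 0 1)
      ∂(gaussianReal τ₀ (σ₀ ^ 2).toNNReal) = selectedMean τ₀ σ₀ (c * b) h := by
  rw [selectedMean, integral_prod]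
  exact (integrable_fst_gaussian_prod τ₀ σ₀).indicator
    (s := {p : ℝ × ℝ | h < p.1 + c * b * p.2}) (measurableSet_lt (by fun_prop) (by fun_prop))

lemma integrable_selectedMean {h : ℝ → ℝ} (hh : Measurable h) (c : ℝ) :
    Integrable (fun b => selectedMean τ₀ σ₀ (c * b) (h b)) ν := by
  have := (integrable_threshold_triple τ₀ σ₀ ν hh c).integral_prod_left.integral_prod_right
  simpa only [integral_integral_threshold] using this

lemma integral_threshold_triple {h : ℝ → ℝ} (hh : Measurable h) (c : ℝ) :
    ∫ p : (ℝ × ℝ) × ℝ, (if h p.1.2 < p.1.1 + c * p.1.2 * p.2 then p.1.1 else 0)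
      ∂(((gaussianReal τ₀ (σ₀ ^ 2).toNNReal).prod ν).prod (gaussianReal 0 1)) =
    ∫ b, selectedMean τ₀ σ₀ (c * b) (h b) ∂ν := by
  have hint := integrable_threshold_triple τ₀ σ₀ ν hh c
  -- The order of integration is noise, then effect, with `b` outermost, so the threshold `h b` is
  -- constant in the inner integrals.
  rw [integral_prod _ hint, integral_prod_symm _ hint.integral_prod_left]
  simp only [integral_integral_threshold]

variable {ν} in
lemma memLp_mul_snd_triple (c : ℝ) (hν : MemLp (fun b : ℝ => b) 2 ν) :
    MemLp (fun p : (ℝ × ℝ) × ℝ => c * p.1.2 * p.2) 2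
      (((gaussianReal τ₀ (σ₀ ^ 2).toNNReal).prod ν).prod (gaussianReal 0 1)) := by
  rw [memLp_two_iff_integrable_sq (by fun_prop)]
  have h1 : Integrable (fun q : ℝ × ℝ => q.2 ^ 2)
      ((gaussianReal τ₀ (σ₀ ^ 2).toNNReal).prod ν) := hν.integrable_sq.comp_snd _
  have h2 : Integrable (fun y : ℝ => y ^ 2) (gaussianReal 0 1) :=
    (memLp_id_gaussianReal' 2 (by simp)).integrable_sq
  refine ((h1.mul_prod h2).const_mul (c ^ 2)).congr (Eventually.of_forall fun p => ?_)
  dsimp only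
  ring

variable {ν} in
lemma memLp_estimate_triple (c : ℝ) (hν : MemLp (fun b : ℝ => b) 2 ν) :
    MemLp (fun p : (ℝ × ℝ) × ℝ => p.1.1 + c * p.1.2 * p.2) 2
      (((gaussianReal τ₀ (σ₀ ^ 2).toNNReal).prod ν).prod (gaussianReal 0 1)) :=
  (((memLp_id_gaussianReal' (μ := τ₀) (v := (σ₀ ^ 2).toNNReal) 2 (by simp)).comp_fst ν).comp_fst
    _).add (memLp_mul_snd_triple τ₀ σ₀ c hν)

variable {ν} in
lemma integral_estimate_triple (c : ℝ) (hν : MemLp (fun b : ℝ => b) 2 ν) :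
    ∫ p : (ℝ × ℝ) × ℝ, (p.1.1 + c * p.1.2 * p.2)
      ∂(((gaussianReal τ₀ (σ₀ ^ 2).toNNReal).prod ν).prod (gaussianReal 0 1)) = τ₀ := by
  rw [integral_add (integrable_fst_gaussian_triple τ₀ σ₀ ν)
    ((memLp_mul_snd_triple τ₀ σ₀ c hν).integrable (by norm_num)),
    integral_prod_mul (fun q : ℝ × ℝ => c * q.2) (fun y : ℝ => y), integral_id_gaussianReal,
    mul_zero, add_zero, integral_fun_fst (fun q : ℝ × ℝ => q.1), integral_fun_fst (fun t : ℝ => t),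
    integral_id_gaussianReal]
  simp

variable {ν} in
lemma integral_estimate_sq_triple (c : ℝ) (hν : MemLp (fun b : ℝ => b) 2 ν) :
    ∫ p : (ℝ × ℝ) × ℝ, (p.1.1 + c * p.1.2 * p.2) ^ 2
      ∂(((gaussianReal τ₀ (σ₀ ^ 2).toNNReal).prod ν).prod (gaussianReal 0 1)) =
    τ₀ ^ 2 + σ₀ ^ 2 + c ^ 2 * ∫ b, b ^ 2 ∂ν := by
  have hsq : ∀ (m : ℝ) (v : NNReal), ∫ x, x ^ 2 ∂(gaussianReal m v) = m ^ 2 + v := fun m v => by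
    have h := variance_eq_sub (memLp_id_gaussianReal' (μ := m) (v := v) 2 (by simp))
    rw [variance_id_gaussianReal] at h
    simp only [Pi.pow_apply, id, integral_id_gaussianReal] at h
    linarith
  have hγ : MemLp (fun t : ℝ => t) 2 (gaussianReal τ₀ (σ₀ ^ 2).toNNReal) :=
    memLp_id_gaussianReal' 2 (by simp)
  have hT : MemLp (fun p : (ℝ × ℝ) × ℝ => p.1.1) 2
      (((gaussianReal τ₀ (σ₀ ^ 2).toNNReal).prod ν).prod (gaussianReal 0 1)) :=
    (hγ.comp_fst ν).comp_fst _
  have hW := memLp_mul_snd_triple τ₀ σ₀ c hν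
  have hTW : Integrable (fun p : (ℝ × ℝ) × ℝ => 2 * (p.1.1 * (c * p.1.2 * p.2)))
      (((gaussianReal τ₀ (σ₀ ^ 2).toNNReal).prod ν).prod (gaussianReal 0 1)) :=
    (hT.integrable_mul hW).const_mul 2
  have hexp : ∀ p : (ℝ × ℝ) × ℝ, (p.1.1 + c * p.1.2 * p.2) ^ 2 =
      p.1.1 ^ 2 + 2 * (p.1.1 * (c * p.1.2 * p.2)) + (c * p.1.2 * p.2) ^ 2 := fun p => by ring
  have hcross : ∫ p : (ℝ × ℝ) × ℝ, p.1.1 * (c * p.1.2 * p.2)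
      ∂(((gaussianReal τ₀ (σ₀ ^ 2).toNNReal).prod ν).prod (gaussianReal 0 1)) = 0 := by
    have : ∀ p : (ℝ × ℝ) × ℝ, p.1.1 * (c * p.1.2 * p.2) = p.1.1 * (c * p.1.2) * p.2 := fun p => by
      ring
    simp only [this]
    rw [integral_prod_mul (fun q : ℝ × ℝ => q.1 * (c * q.2)) (fun y : ℝ => y),
      integral_id_gaussianReal, mul_zero]
  have hlast : ∫ p : (ℝ × ℝ) × ℝ, (c * p.1.2 * p.2) ^ 2
      ∂(((gaussianReal τ₀ (σ₀ ^ 2).toNNReal).prod ν).prod (gaussianReal 0 1)) =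
      c ^ 2 * ∫ b, b ^ 2 ∂ν := by
    have : ∀ p : (ℝ × ℝ) × ℝ, (c * p.1.2 * p.2) ^ 2 = c ^ 2 * p.1.2 ^ 2 * p.2 ^ 2 := fun p => by
      ring
    simp only [this]
    rw [integral_prod_mul (fun q : ℝ × ℝ => c ^ 2 * q.2 ^ 2) (fun y : ℝ => y ^ 2), hsq,
      integral_fun_snd (fun b : ℝ => c ^ 2 * b ^ 2), integral_const_mul]
    simp
  simp only [hexp]
  have h12 : Integrable (fun p : (ℝ × ℝ) × ℝ => p.1.1 ^ 2 + 2 * (p.1.1 * (c * p.1.2 * p.2)))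
      (((gaussianReal τ₀ (σ₀ ^ 2).toNNReal).prod ν).prod (gaussianReal 0 1)) :=
    hT.integrable_sq.add hTW
  rw [integral_add h12 hW.integrable_sq, integral_add hT.integrable_sq hTW, integral_const_mul,
    hcross, hlast, integral_fun_fst (fun q : ℝ × ℝ => q.1 ^ 2),
    integral_fun_fst (fun t : ℝ => t ^ 2), hsq, Real.coe_toNNReal _ (sq_nonneg _)]
  simp

omit [IsProbabilityMeasure ν] in
variable {ν} in
-- For fixed effect and `b > 0` the estimate is an injective function of the Gaussian noise, which
-- has no atoms.
lemma ae_estimate_ne_triple {c : ℝ} (hc : 0 < c) (hν : ∀ᵐ b ∂ν, 0 < b) {h : ℝ → ℝ}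
    (hh : Measurable h) :
    ∀ᵐ p ∂(((gaussianReal τ₀ (σ₀ ^ 2).toNNReal).prod ν).prod (gaussianReal 0 1)),
      p.1.1 + c * p.1.2 * p.2 ≠ h p.1.2 := by
  have hset : MeasurableSet {p : (ℝ × ℝ) × ℝ | p.1.1 + c * p.1.2 * p.2 = h p.1.2} :=
    measurableSet_eq_fun (by fun_prop) (by fun_prop)
  have hpos : ∀ᵐ q ∂((gaussianReal τ₀ (σ₀ ^ 2).toNNReal).prod ν), 0 < q.2 :=
    Measure.quasiMeasurePreserving_snd.ae hν
  rw [ae_iff]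
  simp only [ne_eq, not_not]
  rw [Measure.measure_prod_null hset]
  filter_upwards [hpos] with q hq
  have := nullSingletonClass_gaussianReal (μ := 0) (v := 1) one_ne_zero
  refine Set.Subsingleton.measure_zero (fun x hx y hy => ?_) _
  simp only [Set.mem_preimage, Set.mem_ofPred_eq] at hx hy
  have hcq : c * q.2 ≠ 0 := by positivity
  exact mul_left_cancel₀ hcq (by linarith)

end JointLaw

/-! ### Strong laws for the observed triples. -/

namespace Experiments

namespace IsOLSModel

variable {Ω : Type*} [MeasurableSpace Ω] {P : Measure Ω} [IsProbabilityMeasure P] {N d : ℕ}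
  {τ₀ σ₀ σ : ℝ} {E : Experiments Ω N d}

lemma isProbabilityMeasure_map_b (hE : E.IsOLSModel P τ₀ σ₀ σ) :
    IsProbabilityMeasure (P.map (E.b 0)) :=
  Measure.isProbabilityMeasure_map (hE.measurable_b 0).aemeasurable

omit [IsProbabilityMeasure P] in
lemma memLp_map_b (hE : E.IsOLSModel P τ₀ σ₀ σ) :
    MemLp (fun b : ℝ => b) 2 (P.map (E.b 0)) := by
  have h := hE.measurable_b 0
  rw [memLp_two_iff_integrable_sq (by fun_prop), integrable_map_measure (by fun_prop)
    h.aemeasurable]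
  exact hE.integrable_b_sq

lemma integral_obs (hE : E.IsOLSModel P τ₀ σ₀ σ) (hN : 0 < N) (k : ℕ) {f : ℝ × ℝ × ℝ → ℝ}
    (hf : Measurable f) :
    ∫ ω, f (E.obs k ω) ∂P = ∫ p : (ℝ × ℝ) × ℝ,
      f (p.1.1, p.1.2, p.1.1 + σ / √(N : ℝ) * p.1.2 * p.2)
      ∂(((gaussianReal τ₀ (σ₀ ^ 2).toNNReal).prod (P.map (E.b 0))).prod (gaussianReal 0 1)) := by
  rw [← integral_map (hE.measurable_obs k).aemeasurable hf.aestronglyMeasurable, hE.map_obs hN,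
    jointLaw, integral_map (by fun_prop) hf.aestronglyMeasurable]

lemma integrable_obs_iff (hE : E.IsOLSModel P τ₀ σ₀ σ) (hN : 0 < N) (k : ℕ) {f : ℝ × ℝ × ℝ → ℝ}
    (hf : Measurable f) :
    Integrable (fun ω => f (E.obs k ω)) P ↔ Integrable (fun p : (ℝ × ℝ) × ℝ =>
      f (p.1.1, p.1.2, p.1.1 + σ / √(N : ℝ) * p.1.2 * p.2))
      (((gaussianReal τ₀ (σ₀ ^ 2).toNNReal).prod (P.map (E.b 0))).prod (gaussianReal 0 1)) := by
  have h1 := integrable_map_measure (μ := P) (f := E.obs k) hf.aestronglyMeasurable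
    (hE.measurable_obs k).aemeasurable
  rw [hE.map_obs hN, jointLaw, integrable_map_measure hf.aestronglyMeasurable
    (by fun_prop)] at h1
  exact h1.symm

/-- The strong law of large numbers for functions of the observations. -/
lemma ae_tendsto_avg_obs (hE : E.IsOLSModel P τ₀ σ₀ σ) (hN : 0 < N) {f : ℝ × ℝ × ℝ → ℝ}
    (hf : Measurable f) (hint : Integrable (fun ω => f (E.obs 0 ω)) P) :
    ∀ᵐ ω ∂P, Tendsto (fun K => avg K fun k => f (E.obs k ω)) atTop
      (𝓝 (∫ ω, f (E.obs 0 ω) ∂P)) :=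
  ae_tendsto_avg_comp hE.pairwise_indepFun_obs (hE.identDistrib_obs hN) hf hint

lemma ae_tendsto_tauHat0 (hE : E.IsOLSModel P τ₀ σ₀ σ) (hN : 0 < N) :
    ∀ᵐ ω ∂P, Tendsto (fun K => E.tauHat0 K ω) atTop (𝓝 τ₀) := by
  have := hE.isProbabilityMeasure_map_b
  have hf : Measurable fun x : ℝ × ℝ × ℝ => x.2.2 := by fun_prop
  have h := hE.ae_tendsto_avg_obs hN hf ((hE.integrable_obs_iff hN 0 hf).2
    ((memLp_estimate_triple τ₀ σ₀ _ hE.memLp_map_b).integrable (by norm_num)))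
  rwa [hE.integral_obs hN 0 hf, integral_estimate_triple τ₀ σ₀ _ hE.memLp_map_b] at h

lemma ae_tendsto_avg_tauHat_sq (hE : E.IsOLSModel P τ₀ σ₀ σ) (hN : 0 < N) :
    ∀ᵐ ω ∂P, Tendsto (fun K => avg K fun k => E.tauHat k ω ^ 2) atTop
      (𝓝 (τ₀ ^ 2 + σ₀ ^ 2 + σ ^ 2 / N * ∫ b, b ^ 2 ∂(P.map (E.b 0)))) := by
  have := hE.isProbabilityMeasure_map_b
  have hf : Measurable fun x : ℝ × ℝ × ℝ => x.2.2 ^ 2 := by fun_prop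
  have h := hE.ae_tendsto_avg_obs hN hf ((hE.integrable_obs_iff hN 0 hf).2
    (memLp_estimate_triple τ₀ σ₀ _ hE.memLp_map_b).integrable_sq)
  rwa [hE.integral_obs hN 0 hf, integral_estimate_sq_triple τ₀ σ₀ _ hE.memLp_map_b, div_pow,
    Real.sq_sqrt (Nat.cast_nonneg N)] at h

lemma ae_tendsto_avg_b_sq (hE : E.IsOLSModel P τ₀ σ₀ σ) (hN : 0 < N) :
    ∀ᵐ ω ∂P, Tendsto (fun K => avg K fun k => E.b k ω ^ 2) atTop
      (𝓝 (∫ b, b ^ 2 ∂(P.map (E.b 0)))) := by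
  have hf : Measurable fun x : ℝ × ℝ × ℝ => x.2.1 ^ 2 := by fun_prop
  have hobs : ∀ k ω, (E.obs k ω).2.1 = E.b k ω := fun _ _ => rfl
  have hint : Integrable (fun ω => (E.obs 0 ω).2.1 ^ 2) P := by
    simpa only [hobs] using hE.integrable_b_sq
  have h := hE.ae_tendsto_avg_obs hN (f := fun x => x.2.1 ^ 2) hf hint
  simp only [hobs] at h
  rwa [integral_map (hE.measurable_b 0).aemeasurable (by fun_prop)]

omit [IsProbabilityMeasure P] in
lemma integrable_τ (hE : E.IsOLSModel P τ₀ σ₀ σ) (k : ℕ) : Integrable (E.τ k) P := by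
  have h : Integrable (fun t : ℝ => t) (P.map (E.τ k)) := by
    rw [hE.law_τ]
    exact (memLp_id_gaussianReal' 1 (by simp)).integrable le_rfl
  exact h.comp_measurable (hE.measurable_τ k)

omit [IsProbabilityMeasure P] in
lemma integrable_threshold (hE : E.IsOLSModel P τ₀ σ₀ σ) (k : ℕ) {h : ℝ → ℝ}
    (hh : Measurable h) :
    Integrable (fun ω => if h (E.b k ω) < E.tauHat k ω then E.τ k ω else 0) P :=
  (hE.integrable_τ k).indicator (s := {ω | h (E.b k ω) < E.tauHat k ω})
    (measurableSet_lt (hh.comp (hE.measurable_b k)) (hE.measurable_tauHat k))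

lemma integral_threshold (hE : E.IsOLSModel P τ₀ σ₀ σ) (hN : 0 < N) (k : ℕ) {h : ℝ → ℝ}
    (hh : Measurable h) :
    ∫ ω, (if h (E.b k ω) < E.tauHat k ω then E.τ k ω else 0) ∂P =
      ∫ b, selectedMean τ₀ σ₀ (σ / √(N : ℝ) * b) (h b) ∂(P.map (E.b 0)) := by
  have := hE.isProbabilityMeasure_map_b
  rw [← integral_threshold_triple τ₀ σ₀ _ hh]
  exact hE.integral_obs hN k (f := fun x => if h x.2.1 < x.2.2 then x.1 else 0)
    (Measurable.ite (measurableSet_lt (by fun_prop) (by fun_prop)) measurable_fst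
      measurable_const)

lemma ae_tendsto_avg_threshold (hE : E.IsOLSModel P τ₀ σ₀ σ) (hN : 0 < N) {h : ℝ → ℝ}
    (hh : Measurable h) :
    ∀ᵐ ω ∂P, Tendsto (fun K => avg K fun k =>
      if h (E.b k ω) < E.tauHat k ω then E.τ k ω else 0) atTop
      (𝓝 (∫ b, selectedMean τ₀ σ₀ (σ / √(N : ℝ) * b) (h b) ∂(P.map (E.b 0)))) := by
  rw [← hE.integral_threshold hN 0 hh]
  exact hE.ae_tendsto_avg_obs hN (f := fun x => if h x.2.1 < x.2.2 then x.1 else 0)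
    (Measurable.ite (measurableSet_lt (by fun_prop) (by fun_prop)) measurable_fst
      measurable_const) (hE.integrable_threshold 0 hh)

lemma ae_tauHat_ne (hE : E.IsOLSModel P τ₀ σ₀ σ) (hN : 0 < N) (hσ : 0 < σ) {h : ℝ → ℝ}
    (hh : Measurable h) : ∀ᵐ ω ∂P, E.tauHat 0 ω ≠ h (E.b 0 ω) := by
  have hset : MeasurableSet {x : ℝ × ℝ × ℝ | x.2.2 ≠ h x.2.1} :=
    (measurableSet_eq_fun (by fun_prop) (by fun_prop)).compl
  have hb : ∀ᵐ b ∂(P.map (E.b 0)), 0 < b :=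
    (ae_map_iff (hE.measurable_b 0).aemeasurable measurableSet_Ioi).2 (hE.ae_b_pos hN 0)
  refine (ae_map_iff (hE.measurable_obs 0).aemeasurable hset).1 ?_
  rw [hE.map_obs hN, jointLaw, ae_map_iff (by fun_prop) hset]
  exact ae_estimate_ne_triple τ₀ σ₀ (by positivity) hb hh

/-- The strong law identifies `e m` as the mean of `|τ|` near the threshold. These means tend to 0
by dominated convergence, because `τ̂` almost surely misses the threshold. -/
lemma exists_tendsto_avg_near_threshold (hE : E.IsOLSModel P τ₀ σ₀ σ) (hN : 0 < N) (hσ : 0 < σ)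
    (c : ℝ) : ∃ e : ℕ → ℝ, Tendsto e atTop (𝓝 0) ∧ ∀ᵐ ω ∂P, ∀ m : ℕ,
      Tendsto (fun K => avg K fun k =>
        if |E.tauHat k ω + c * E.b k ω ^ 2| ≤ 1 / ((m : ℝ) + 1) * E.b k ω ^ 2
          then |E.τ k ω| else 0) atTop (𝓝 (e m)) := by
  let f : ℕ → ℝ × ℝ × ℝ → ℝ := fun m x =>
    if |x.2.2 + c * x.2.1 ^ 2| ≤ 1 / ((m : ℝ) + 1) * x.2.1 ^ 2 then |x.1| else 0
  have hset : ∀ m : ℕ, MeasurableSet {x : ℝ × ℝ × ℝ |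
      |x.2.2 + c * x.2.1 ^ 2| ≤ 1 / ((m : ℝ) + 1) * x.2.1 ^ 2} := fun m =>
    measurableSet_le (by fun_prop) (by fun_prop)
  have hf : ∀ m, Measurable (f m) := fun m =>
    Measurable.ite (hset m) (by fun_prop) measurable_const
  have hτ := hE.integrable_τ 0
  have hint : ∀ m, Integrable (fun ω => f m (E.obs 0 ω)) P := fun m =>
    hτ.abs.indicator (hE.measurable_obs 0 (hset m))
  refine ⟨fun m => ∫ ω, f m (E.obs 0 ω) ∂P, ?_,
    ae_all_iff.2 fun m => hE.ae_tendsto_avg_obs hN (hf m) (hint m)⟩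
  rw [← integral_zero Ω ℝ (μ := P)]
  refine tendsto_integral_of_dominated_convergence (fun ω => |E.τ 0 ω|)
    (fun m => (hint m).aestronglyMeasurable) hτ.abs
    (fun m => Eventually.of_forall fun ω => ?_) ?_
  · simp only [f, obs]
    split_ifs <;> simp
  · filter_upwards [hE.ae_tauHat_ne hN hσ (h := fun b => -(c * b ^ 2)) (by fun_prop)] with ω hω
    have hpos : 0 < |E.tauHat 0 ω + c * E.b 0 ω ^ 2| :=
      abs_pos.2 fun h => hω (by linarith)
    have hlim := (tendsto_one_div_add_atTop_nhds_zero_nat (𝕜 := ℝ)).mul_const (E.b 0 ω ^ 2)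
    rw [zero_mul] at hlim
    refine tendsto_const_nhds.congr' ?_
    filter_upwards [hlim.eventually (gt_mem_nhds hpos)] with m hm
    simp only [f, obs]
    rw [if_neg (not_le.2 hm)]

end IsOLSModel

end Experiments

lemma betaStar_mem_scaleFunctions (N : ℕ) {τ₀ σ₀ σ z : ℝ} (hτ₀ : 0 < τ₀) (hσ : 0 < σ)
    (hz : 0 ≤ z) : betaStar N τ₀ σ₀ σ z ∈ scaleFunctions := by
  refine ⟨?_, fun b hb => ?_⟩
  · unfold betaStar
    fun_prop
  · unfold betaStar
    positivity

/-- The threshold induced by `β*` is the zero of the posterior mean for noise level `σ b / √N`. -/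
lemma betaStar_threshold {N : ℕ} (hN : 0 < N) {τ₀ : ℝ} (hτ₀ : 0 < τ₀) (σ₀ σ z b : ℝ) :
    σ * b / √(N : ℝ) * z - betaStar N τ₀ σ₀ σ z b * τ₀ / N =
      -((σ / √(N : ℝ) * b) ^ 2 * τ₀ / σ₀ ^ 2) := by
  have hN' : (0 : ℝ) < N := Nat.cast_pos.2 hN
  have h1 : betaStar N τ₀ σ₀ σ z b =
      σ ^ 2 / σ₀ ^ 2 * b ^ 2 + z * b * (√(N : ℝ) * σ) / τ₀ := by
    unfold betaStar
    ring
  rw [h1, threshold_cancel hN' _ _ _ _ _ hτ₀.ne', mul_pow, div_pow, Real.sq_sqrt hN'.le]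
  ring

/-! ### Limiting reward, its maximizer, and the limits in probability. -/

namespace Experiments

variable {Ω : Type*} [MeasurableSpace Ω] {P : Measure Ω} {N d : ℕ}
  {τ₀ σ₀ σ : ℝ} {E : Experiments Ω N d}

/-- The limiting expected reward of the scale function `β` with anchor `τ₀`. -/
def limitReward (E : Experiments Ω N d) (P : Measure Ω) (τ₀ σ₀ σ z : ℝ) (β : ℝ → ℝ) : ℝ :=
  ∫ b, selectedMean τ₀ σ₀ (σ / √(N : ℝ) * b) (σ * b / √(N : ℝ) * z - β b * τ₀ / N)
    ∂(P.map (E.b 0))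

namespace IsOLSModel

lemma reward_ae_eq (hE : E.IsOLSModel P τ₀ σ₀ σ) (hN : 0 < N) (z : ℝ) {β : ℝ → ℝ}
    (hβ : β ∈ scaleFunctions) (K : ℕ) :
    (fun ω => E.reward z σ β τ₀ K ω) =ᵐ[P] fun ω => avg K fun k =>
      if σ * E.b k ω / √(N : ℝ) * z - β (E.b k ω) * τ₀ / N < E.tauHat k ω
        then E.τ k ω else 0 := by
  filter_upwards [ae_all_iff.2 (hE.ae_b_pos hN)] with ω hω
  exact E.reward_eq_avg_threshold hN fun k => hβ.2 _ (hω k)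

lemma integrable_reward (hE : E.IsOLSModel P τ₀ σ₀ σ) (hN : 0 < N) (z : ℝ) {β : ℝ → ℝ}
    (hβ : β ∈ scaleFunctions) (K : ℕ) : Integrable (fun ω => E.reward z σ β τ₀ K ω) P := by
  have hm := hβ.1
  have hh : Measurable fun b => σ * b / √(N : ℝ) * z - β b * τ₀ / N := by fun_prop
  refine Integrable.congr ?_ (hE.reward_ae_eq hN z hβ K).symm
  exact (integrable_finsetSum _ fun k _ => hE.integrable_threshold k hh).const_mul _

variable [IsProbabilityMeasure P]

lemma tendsto_integral_reward (hE : E.IsOLSModel P τ₀ σ₀ σ) (hN : 0 < N) (z : ℝ) {β : ℝ → ℝ}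
    (hβ : β ∈ scaleFunctions) :
    Tendsto (fun K : ℕ => ∫ ω, E.reward z σ β τ₀ K ω ∂P) atTop
      (𝓝 (E.limitReward P τ₀ σ₀ σ z β)) := by
  have hm := hβ.1
  have hh : Measurable fun b => σ * b / √(N : ℝ) * z - β b * τ₀ / N := by fun_prop
  -- For every `K > 0` the expectation already equals the limit; `K = 0` is excluded because the
  -- empty average is 0.
  refine tendsto_const_nhds.congr' ?_
  filter_upwards [eventually_gt_atTop 0] with K hK
  have hK' : (K : ℝ) ≠ 0 := Nat.cast_ne_zero.2 hK.ne'
  rw [integral_congr_ae (hE.reward_ae_eq hN z hβ K)]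
  simp only [avg]
  rw [integral_const_mul, integral_finsetSum _ fun k _ => hE.integrable_threshold k hh]
  simp only [hE.integral_threshold hN _ hh, Finset.sum_const, Finset.card_range, nsmul_eq_mul]
  rw [limitReward, ← mul_assoc, one_div_mul_cancel hK', one_mul]

/-- `betaStar` is the essentially unique maximizer of the limiting expected reward. -/
lemma limitReward_le_and_ae_eq (hE : E.IsOLSModel P τ₀ σ₀ σ) (hN : 0 < N) (hτ₀ : 0 < τ₀)
    (hσ₀ : 0 < σ₀) (z : ℝ) {β : ℝ → ℝ} (hβ : Measurable β) :
    E.limitReward P τ₀ σ₀ σ z β ≤ E.limitReward P τ₀ σ₀ σ z (betaStar N τ₀ σ₀ σ z) ∧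
    (E.limitReward P τ₀ σ₀ σ z β = E.limitReward P τ₀ σ₀ σ z (betaStar N τ₀ σ₀ σ z) →
      ∀ k, ∀ᵐ ω ∂P, β (E.b k ω) = betaStar N τ₀ σ₀ σ z (E.b k ω)) := by
  have hN' : (0 : ℝ) < N := Nat.cast_pos.2 hN
  have := hE.isProbabilityMeasure_map_b
  have hmstar : Measurable (betaStar N τ₀ σ₀ σ z) := by
    unfold betaStar
    fun_prop
  have hint : ∀ β : ℝ → ℝ, Measurable β → Integrable (fun b => selectedMean τ₀ σ₀
      (σ / √(N : ℝ) * b) (σ * b / √(N : ℝ) * z - β b * τ₀ / N)) (P.map (E.b 0)) := fun β hβ =>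
    integrable_selectedMean τ₀ σ₀ _ (h := fun b => σ * b / √(N : ℝ) * z - β b * τ₀ / N)
      (by fun_prop) _
  have hopt := fun b => selectedMean_le_and_eq_iff τ₀ σ₀ (σ / √(N : ℝ) * b) hσ₀
    (σ * b / √(N : ℝ) * z - β b * τ₀ / N)
  simp only [← betaStar_threshold hN hτ₀ σ₀ σ z] at hopt
  refine ⟨integral_mono (hint β hβ) (hint _ hmstar) fun b => (hopt b).1, fun heq k => ?_⟩
  -- Equal integrals of pointwise ordered functions force almost everywhere equality, so uniqueness
  -- for each `b` applies.
  have hz := (integral_eq_iff_of_ae_le (hint β hβ) (hint _ hmstar)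
    (Eventually.of_forall fun b => (hopt b).1)).1 heq
  have hae : ∀ᵐ b ∂(P.map (E.b 0)), β b = betaStar N τ₀ σ₀ σ z b := by
    filter_upwards [hz] with b hb
    have h := (hopt b).2 hb
    have h2 : β b * τ₀ / N = betaStar N τ₀ σ₀ σ z b * τ₀ / N := by linarith
    exact mul_right_cancel₀ hτ₀.ne' ((div_left_inj' hN'.ne').1 h2)
  rw [← (hE.identDistrib_b k).map_eq] at hae
  exact (ae_map_iff (hE.measurable_b k).aemeasurable (measurableSet_eq_fun hβ hmstar)).1 hae

/-- Along a subsequence of every subsequence, all pooled statistics converge almost surely. -/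
lemma exists_subseq_ae_tendsto (hE : E.IsOLSModel P τ₀ σ₀ σ) (hN : d + 2 < N) (hσ₀ : 0 < σ₀)
    {ns : ℕ → ℕ} (hns : StrictMono ns) : ∃ ns' : ℕ → ℕ, StrictMono ns' ∧ ∀ᵐ ω ∂P,
      Tendsto (fun i => E.tauHat0 (ns (ns' i)) ω) atTop (𝓝 τ₀) ∧
      Tendsto (fun i => E.sigmaHatSq (ns (ns' i)) ω) atTop (𝓝 (σ ^ 2)) ∧
      Tendsto (fun i => E.varianceRatio (ns (ns' i)) ω) atTop (𝓝 (σ ^ 2 / σ₀ ^ 2)) := by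
  have hN0 : 0 < N := by omega
  -- Only `σ̂²` requires a subsequence; the other averages converge almost surely.
  obtain ⟨ns', hns', hs⟩ := (exists_seq_tendstoInMeasure_atTop_iff fun K =>
    (hE.measurable_sigmaHatSq K).aestronglyMeasurable).1 (hE.tendstoInMeasure_sigmaHatSq hN) ns hns
  refine ⟨ns', hns', ?_⟩
  have hlim : Tendsto (fun i => ns (ns' i)) atTop atTop := (hns.comp hns').tendsto_atTop
  filter_upwards [hs, hE.ae_tendsto_tauHat0 hN0, hE.ae_tendsto_avg_tauHat_sq hN0,
    hE.ae_tendsto_avg_b_sq hN0] with ω h1 h2 h3 h4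
  exact ⟨h2.comp hlim, h1, E.tendsto_varianceRatio hσ₀ hlim h2 h3 h4 h1⟩

lemma tendstoInMeasure_tauHat0 (hE : E.IsOLSModel P τ₀ σ₀ σ) (hN : 0 < N) :
    TendstoInMeasure P (fun K ω => E.tauHat0 K ω) atTop (fun _ => τ₀) :=
  tendstoInMeasure_of_tendsto_ae (fun K => (hE.measurable_tauHat0 K).aestronglyMeasurable)
    (hE.ae_tendsto_tauHat0 hN)

lemma tendstoInMeasure_betaHat (hE : E.IsOLSModel P τ₀ σ₀ σ) (hN : d + 2 < N) (hτ₀ : 0 < τ₀)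
    (hσ₀ : 0 < σ₀) (hσ : 0 < σ) (z : ℝ) {x : Ω → ℝ} (hx : Measurable x) :
    TendstoInMeasure P (fun K ω => E.betaHat z K ω (x ω)) atTop
      (fun ω => betaStar N τ₀ σ₀ σ z (x ω)) := by
  rw [exists_seq_tendstoInMeasure_atTop_iff fun K =>
    (hE.measurable_betaHat_comp z K hx).aestronglyMeasurable]
  intro ns hns
  obtain ⟨ns', hns', h⟩ := hE.exists_subseq_ae_tendsto hN hσ₀ hns
  refine ⟨ns', hns', ?_⟩
  filter_upwards [h] with ω hω
  exact E.tendsto_betaHat (ns := fun i => ns (ns' i)) hτ₀ hσ z _ hω.1 hω.2.2 hω.2.1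

lemma tendstoInMeasure_reward_betaHat (hE : E.IsOLSModel P τ₀ σ₀ σ) (hN : d + 2 < N)
    (hτ₀ : 0 < τ₀) (hσ₀ : 0 < σ₀) (hσ : 0 < σ) {z : ℝ} (hz : 0 ≤ z) :
    TendstoInMeasure P
      (fun K ω => E.reward z (E.sigmaHat K ω) (E.betaHat z K ω) (E.tauHat0 K ω) K ω)
      atTop (fun _ => E.limitReward P τ₀ σ₀ σ z (betaStar N τ₀ σ₀ σ z)) := by
  have hN0 : 0 < N := by omega
  have hN' : (0 : ℝ) < N := Nat.cast_pos.2 hN0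
  set c := σ ^ 2 / σ₀ ^ 2 * τ₀ / N with hc
  have hstar : E.limitReward P τ₀ σ₀ σ z (betaStar N τ₀ σ₀ σ z) =
      ∫ b, selectedMean τ₀ σ₀ (σ / √(N : ℝ) * b) (-(c * b ^ 2)) ∂(P.map (E.b 0)) := by
    rw [limitReward]
    congr 1
    funext b
    rw [betaStar_threshold hN0 hτ₀, hc, mul_pow, div_pow, Real.sq_sqrt hN'.le]
    congr 1
    ring
  rw [hstar, exists_seq_tendstoInMeasure_atTop_iff fun K =>
    (hE.measurable_reward_betaHat z K).aestronglyMeasurable]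
  intro ns hns
  obtain ⟨ns', hns', h⟩ := hE.exists_subseq_ae_tendsto hN hσ₀ hns
  refine ⟨ns', hns', ?_⟩
  have hlim : Tendsto (fun i => ns (ns' i)) atTop atTop := (hns.comp hns').tendsto_atTop
  obtain ⟨e, he, hnear⟩ := hE.exists_tendsto_avg_near_threshold hN0 hσ c
  filter_upwards [h, hnear, ae_all_iff.2 (hE.ae_b_pos hN0),
    hE.ae_tendsto_avg_threshold hN0 (h := fun b => -(c * b ^ 2)) (by fun_prop)]
    with ω ⟨h1, _, h3⟩ h4 h5 h6
  have hcs := (h3.mul h1).div_const (N : ℝ)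
  refine (tendsto_avg_threshold h6 h4 he hlim hcs).congr' ?_
  have hratio : 0 < σ ^ 2 / σ₀ ^ 2 := by positivity
  -- The positive limits make the pooled statistics eventually positive on each path, as the
  -- cancellation of the critical value requires.
  filter_upwards [h1.eventually (lt_mem_nhds hτ₀), h3.eventually (lt_mem_nhds hratio)]
    with i hi1 hi3
  exact (E.reward_betaHat_eq hN0 hz h5 hi3.le hi1).symm

end IsOLSModel

end Experiments

end DPTR

end

theorem theorem5 {Ω : Type*} [MeasurableSpace Ω] (P : Measure Ω) [IsProbabilityMeasure P]
    (N d : ℕ) (hN : d + 2 < N)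
    (τ₀ σ₀ σ α : ℝ) (hτ₀ : 0 < τ₀) (hσ₀ : 0 < σ₀) (hσ : 0 < σ) (hα₀ : 0 < α) (hα₁ : α < 1)
    (E : DPTR.Experiments Ω N d) (hE : E.IsOLSModel P τ₀ σ₀ σ)
    (z : ℝ) (hz : z = DPTR.normalQuantile (1 - α / 2))
    (βstar : ℝ → ℝ) (hβstar : βstar = DPTR.betaStar N τ₀ σ₀ σ z) :
    -- consistency of the pooled anchor
    TendstoInMeasure P (fun K ω => E.tauHat0 K ω) atTop (fun _ => τ₀) ∧
    -- consistency of the plug-in scale, at a fixed argument and at each random `b_k`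
    (∀ x : ℝ, 0 < x →
      TendstoInMeasure P (fun K ω => E.betaHat z K ω x) atTop (fun _ => βstar x)) ∧
    (∀ k : ℕ, TendstoInMeasure P (fun K ω => E.betaHat z K ω (E.b k ω)) atTop
      (fun ω => βstar (E.b k ω))) ∧
    -- the limiting expected reward `R β = lim_K E[r̃(β(·), τ₀)]` exists, its maximizer over the
    -- admissible scale functions is `βstar`, and the data-driven reward converges to `R βstar`
    ∃ R : (ℝ → ℝ) → ℝ,
      (∀ β ∈ DPTR.scaleFunctions,
        (∀ K : ℕ, Integrable (fun ω => E.reward z σ β τ₀ K ω) P) ∧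
        Tendsto (fun K : ℕ => ∫ ω, E.reward z σ β τ₀ K ω ∂P) atTop (𝓝 (R β))) ∧
      βstar ∈ DPTR.scaleFunctions ∧
      (∀ β ∈ DPTR.scaleFunctions, R β ≤ R βstar ∧
        (R β = R βstar → ∀ k : ℕ, ∀ᵐ ω ∂P, β (E.b k ω) = βstar (E.b k ω))) ∧
      TendstoInMeasure P
        (fun K ω => E.reward z (E.sigmaHat K ω) (E.betaHat z K ω) (E.tauHat0 K ω) K ω)
        atTop (fun _ => R βstar) := by
  have hN0 : 0 < N := by omega
  have hz0 : 0 ≤ z := hz ▸ DPTR.normalQuantile_nonneg (by linarith)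
  subst hβstar
  exact ⟨hE.tendstoInMeasure_tauHat0 hN0,
    fun x _ => hE.tendstoInMeasure_betaHat hN hτ₀ hσ₀ hσ z measurable_const,
    fun k => hE.tendstoInMeasure_betaHat hN hτ₀ hσ₀ hσ z (hE.measurable_b k),
    E.limitReward P τ₀ σ₀ σ z,
    fun β hβ => ⟨hE.integrable_reward hN0 z hβ, hE.tendsto_integral_reward hN0 z hβ⟩,
    DPTR.betaStar_mem_scaleFunctions N hτ₀ hσ hz0,
    fun β hβ => hE.limitReward_le_and_ae_eq hN0 hτ₀ hσ₀ z hβ.1,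
    hE.tendstoInMeasure_reward_betaHat hN hτ₀ hσ₀ hσ hz0⟩
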